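/- **Setting.** A feeder has nodes $\mathcal N=\{0,\dots,N\}$ and undirected lines $\mathcal E$; line $(m,n)$ has series admittance $y_{mn}\in\mathbb C$ and shunt admittance $y^{\rm sh}_{mn}\in\mathbb C$. The admittance matrix $Y$ has entries $Y_{mm}=\sum_{j:(m,j)\in\mathcal E}(y^{\rm sh}_{mj}+y_{mj})$, $Y_{mn}=-y_{mn}$ if $(m,n)\in\mathcal E$, and $0$ otherwise. Put $Y_n=e_ne_n^{\sf T}Y$, $A_n=\frac12(Y_n+Y_n^{\sf H})$, $B_n=\frac{\rm j}2(Y_n-Y_n^{\sf H})$, $M_n=e_ne_n^{\sf T}$. Let $\mathcal U,\mathcal H\subset\mathcal N$ be the utility poles and the houses. House $h$ has loads $P_{\ell,h},Q_{\ell,h}$, available power $P^{\rm av}_h$ and rating $S_h$, and $$\mathcal F_h=\{(P,Q):0\le P\le P^{\rm av}_h,\ Q^2\le S_h^2-(P^{\rm av}_h-P)^2,\ |Q|\le\tan\theta\,(P^{\rm av}_h-P)\},$$ with $0\le\theta\le\pi/2$, where $\theta=\pi/2$ means that the last constraint is absent. *Centralized problem.* Minimize $C_{\rm utility}(V,p)+\sum_hR_h(p_h)+\lambda\sum_h\|(p_h,q_h)\|_2$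 over $V\succeq0$ (of size $(N+1)\times(N+1)$, complex Hermitian) and $p,q\in\mathbb R^{\mathcal H}$ subject to ${\rm Tr}(A_hV)=-P_{\ell,h}+P^{\rm av}_h-p_h$, ${\rm Tr}(B_hV)=-Q_{\ell,h}+q_h$ and $(p_h,q_h)\in\mathcal F_h$ for $h\in\mathcal H$; ${\rm Tr}(A_nV)={\rm Tr}(B_nV)=0$ for $n\in\mathcal U$; and $V_{\min}^2\le{\rm Tr}(M_nV)\le V_{\max}^2$ for $n\in\mathcal N$. *Clusters.* $\mathcal N$ is partitioned into clusters $\mathcal C^1,\dots,\mathcal C^{N_a}$; $\tilde{\mathcal C}^a$ is $\mathcal C^a$ together with the nodes of other clusters joined to it by a line; $\mathcal H^a=\mathcal H\cap\mathcal C^a$; $V^a$ denotes a matrix indexed by $\tilde{\mathcal C}^a$ and, for a network matrix $V$, its sub-matrix at $\tilde{\mathcal C}^a$. Clusters $a\ne j$ are neighbours ($j\in\mathcal B^a$) if $\tilde{\mathcal C}^a\cap\tilde{\mathcal C}^j\ne\emptyset$; $V^a_j$ is the sub-matrix of $V^a$ at the end points of the line(s) between $\mathcal C^a$ and $\mathcal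 C^j$. Let $\mathcal R^a$ be the set of $(V^a,\bar p^a,\bar q^a)$ that satisfy the above trace constraints (other than $\mathcal F_h$) of the nodes of $\mathcal C^a$, with the sub-matrices of $A_n,B_n,M_n$ at $\tilde{\mathcal C}^a$ and with $\bar p,\bar q$ in place of $p,q$. Put $\bar C^a(V^a,\bar p^a,\bar q^a)=C^a(V^a,\bar p^a)+\lambda^a\sum_{h\in\mathcal H^a}\|(\bar p_h,\bar q_h)\|_2$. *Cluster formulation.* Minimize $\sum_a[\bar C^a(V^a,\bar p^a,\bar q^a)+\sum_{h\in\mathcal H^a}R_h(p_h)]$ over $V\succeq0,p,q,\bar p,\bar q$ subject to $(V^a,\bar p^a,\bar q^a)\in\mathcal R^a$ for all $a$, $(p_h,q_h)\in\mathcal F_h$, $\bar p=p$, $\bar q=q$. *Algorithm.* Let $\kappa>0$. Start with $\gamma_h[0]=\mu_h[0]=0$, $\Upsilon_{a,j}[0]=\Psi_{a,j}[0]=0$ and arbitrary $V^a[0],\bar p[0],\bar q[0],p[0],q[0]$. In round $i$: - $(p_h,q_h)[i+1]$ minimizes over $(P,Q)\in\mathcal F_h$ the function $R_h(P)+\frac\kappa2(P^2+Q^2)-P(\gamma_h+\frac\kappa2\bar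 p_h+\frac\kappa2p_h)[i]-Q(\mu_h+\frac\kappa2\bar q_h+\frac\kappa2q_h)[i]$. - For each $a$, $(V^a,\bar p^a,\bar q^a)[i+1]$, with suitable $\alpha_j,\beta_j\ge0$ ($j\in\mathcal B^a$), minimizes $$\bar C^a(V^a,\bar p^a,\bar q^a)+\sum_{h\in\mathcal H^a}\Big[\tfrac\kappa2(\bar p_h^2+\bar q_h^2)+\bar p_h\big(\gamma_h-\tfrac\kappa2\bar p_h-\tfrac\kappa2p_h\big)[i]+\bar q_h\big(\mu_h-\tfrac\kappa2\bar q_h-\tfrac\kappa2q_h\big)[i]\Big]$$ $$+\sum_{j\in\mathcal B^a}\Big[\tfrac\kappa2(\alpha_j+\beta_j)+{\rm Tr}(\Upsilon_{a,j}^{\sf T}[i]\,\Re V^a_j)+{\rm Tr}(\Psi_{a,j}^{\sf T}[i]\,\Im V^a_j)\Big]$$ over $(V^a,\bar p^a,\bar q^a)\in\mathcal R^a$, $V^a\succeq0$, $\begin{bmatrix}-\alpha_j&\mathbf a_j^{\sf T}\\ \mathbf a_j&-I\end{bmatrix}\preceq0$, $\begin{bmatrix}-\beta_j&\mathbf b_j^{\sf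 T}\\ \mathbf b_j&-I\end{bmatrix}\preceq0$, where $\mathbf a_j,\mathbf b_j$ collect the real and imaginary parts of the entries of $V^a_j-\frac12(V^a_j[i]+V^j_a[i])$. - $\gamma_h[i+1]=\gamma_h[i]+\frac\kappa2(\bar p_h-p_h)[i+1]$, $\mu_h[i+1]=\mu_h[i]+\frac\kappa2(\bar q_h-q_h)[i+1]$, $\Upsilon_{a,j}[i+1]=\Upsilon_{a,j}[i]+\frac\kappa2(\Re V^a_j-\Re V^j_a)[i+1]$, $\Psi_{a,j}[i+1]=\Psi_{a,j}[i]+\frac\kappa2(\Im V^a_j-\Im V^j_a)[i+1]$ for all $h$, $a$, $j\in\mathcal B^a$. **Assumptions.** The $R_h$ are convex on $\mathbb R$, each $C^a$ is convex (jointly, on Hermitian matrices times $\mathbb R^{\mathcal H^a}$), $\lambda,\lambda^a\ge0$; the network cost decouples: $C_{\rm utility}(V,p)+\lambda\sum_h\|(p_h,q_h)\|_2=\sum_a\bar C^a(V^a,p^a,q^a)$ for all $V\succeq0$, $p$, $q$; the graph of neighbouring clusters is a tree; and Slater's condition holds: some feasible $(V,p,q)$ of the centralized problem has $V\succ0$ and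 $q_h^2<S_h^2-(P^{\rm av}_h-p_h)^2$ for all $h$. **Proposition.** For every $\kappa>0$ and every sequence of iterates of the algorithm: (a) $p[i]$ and $\bar p[i]$ converge to a common limit $p$, $q[i]$ and $\bar q[i]$ converge to a common limit $q$, all multipliers $\gamma_h[i],\mu_h[i],\Upsilon_{a,j}[i],\Psi_{a,j}[i]$ converge, and $V^a_j[i]$ and $V^j_a[i]$ converge to a common limit for all neighbouring $a,j$. The matrices $V^a[i]$ are bounded, and for each limit point $(W^a)_a$ of $(V^a[i])_a$ there is $V$ with $V^a=W^a$ for all $a$ such that $(V,p,q)$ solves the centralized problem and $(V,p,q,p,q)$ solves the cluster formulation. (b) Suppose that the minimizing cluster voltages are determined by the exchanged quantities, i.e. any two solutions of the cluster formulation with the same setpoints and the same $V^a_j$ (all neighbouring $a,j$) have the same $V^a$ for all $a$. Then all the $V^a[i]$ converge too, so that all iterates converge, and there is $V$ with $V^a=\lim_iV^a[i]$ for all $a$ such that $(V,p,q)$ solves the centralized problem and $(V,p,q,p,q)$ solves the cluster formulation. -/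

import Mathlib

open Filter Topology Matrix
open scoped ComplexOrder

noncomputable section

namespace OID

/-- A balanced feeder with nodes `0, …, N` and its photovoltaic inverters: lines, series and shunt
admittances of the lines, utility poles `U`, houses `H` with their loads, available powers and
inverter ratings, the power-factor angle `θ` and the voltage limits. -/
structure Feeder (N : ℕ) where
  lines : SimpleGraph (Fin (N + 1))
  y : Sym2 (Fin (N + 1)) → ℂ
  ysh : Sym2 (Fin (N + 1)) → ℂ
  U : Finset (Fin (N + 1))
  H : Finset (Fin (N + 1))
  Pl : H → ℝ
  Ql : H → ℝ
  Pav : H → ℝ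
  S : H → ℝ
  θ : ℝ
  Vmin : ℝ
  Vmax : ℝ

namespace Feeder

variable {N : ℕ} (F : Feeder N)

open Classical in
/-- System admittance matrix. -/
def Y : Matrix (Fin (N + 1)) (Fin (N + 1)) ℂ := fun m n =>
  if m = n then ∑ j ∈ F.lines.neighborFinset m, (F.ysh s(m, j) + F.y s(m, j))
  else if F.lines.Adj m n then -F.y s(m, n)
  else 0

/-- `e_n e_nᵀ`. -/
def M (_F : Feeder N) (n : Fin (N + 1)) : Matrix (Fin (N + 1)) (Fin (N + 1)) ℂ :=
  Matrix.single n n 1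

/-- `e_n e_nᵀ Y`. -/
def Yn (n : Fin (N + 1)) : Matrix (Fin (N + 1)) (Fin (N + 1)) ℂ :=
  Matrix.single n n 1 * F.Y

def A (n : Fin (N + 1)) : Matrix (Fin (N + 1)) (Fin (N + 1)) ℂ :=
  (1 / 2 : ℂ) • (F.Yn n + (F.Yn n)ᴴ)

def B (n : Fin (N + 1)) : Matrix (Fin (N + 1)) (Fin (N + 1)) ℂ :=
  (Complex.I / 2) • (F.Yn n - (F.Yn n)ᴴ)

/-- Operating region of the inverter at house `h`: pairs (curtailed active power, reactive power).
The power-factor bound `|Q| ≤ tan θ (Pav - P)` is multiplied by `cos θ`, so that `θ = π / 2` means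
that the power factor is not limited. -/
def region (h : F.H) : Set (ℝ × ℝ) :=
  {x | 0 ≤ x.1 ∧ x.1 ≤ F.Pav h ∧ x.2 ^ 2 ≤ F.S h ^ 2 - (F.Pav h - x.1) ^ 2 ∧
    Real.cos F.θ * |x.2| ≤ Real.sin F.θ * (F.Pav h - x.1)}

end Feeder

/-- A partition of the nodes into `Na` clusters: `cluster n` is the cluster of node `n`. -/
structure Clustering {N : ℕ} (F : Feeder N) (Na : ℕ) where
  cluster : Fin (N + 1) → Fin Na

namespace Clustering

variable {N Na : ℕ} {F : Feeder N} (K : Clustering F Na)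

open Classical in
/-- Extended cluster: the nodes of cluster `a`, and the nodes of other clusters that are connected
to a node of cluster `a` by a line. -/
def ext (a : Fin Na) : Finset (Fin (N + 1)) :=
  Finset.univ.filter fun n =>
    K.cluster n = a ∨ (K.cluster n ≠ a ∧ ∃ m, F.lines.Adj m n ∧ K.cluster m = a)

/-- Houses of cluster `a`. -/
abbrev Houses (a : Fin Na) : Type := {h : F.H // K.cluster h = a}

/-- Clusters are neighbours when their extended clusters meet. -/
def graph : SimpleGraph (Fin Na) where
  Adj a j := a ≠ j ∧ (K.ext a ∩ K.ext j).Nonempty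
  symm := ⟨fun _ _ h => ⟨h.1.symm, by rw [Finset.inter_comm]; exact h.2⟩⟩
  loopless := ⟨fun _ h => h.1 rfl⟩

open Classical in
/-- Neighbouring clusters of `a`. -/
def nbr (a : Fin Na) : Finset (Fin Na) := K.graph.neighborFinset a

open Classical in
/-- End points of the line (or lines) that connect the clusters `a` and `j`. -/
def tie (a j : Fin Na) : Finset (Fin (N + 1)) :=
  Finset.univ.filter fun n => ∃ m, F.lines.Adj n m ∧
    ((K.cluster n = a ∧ K.cluster m = j) ∨ (K.cluster n = j ∧ K.cluster m = a))

theorem tie_subset_left (a j : Fin Na) : K.tie a j ⊆ K.ext a := by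
  classical
  intro n hn
  simp only [tie, ext, Finset.mem_filter, Finset.mem_univ, true_and] at hn ⊢
  obtain ⟨m, hadj, ⟨h, -⟩ | ⟨-, h⟩⟩ := hn
  · exact Or.inl h
  · by_cases hna : K.cluster n = a
    · exact Or.inl hna
    · exact Or.inr ⟨hna, m, hadj.symm, h⟩

theorem tie_subset_right (a j : Fin Na) : K.tie a j ⊆ K.ext j := by
  classical
  intro n hn
  simp only [tie, ext, Finset.mem_filter, Finset.mem_univ, true_and] at hn ⊢
  obtain ⟨m, hadj, ⟨-, h⟩ | ⟨h, -⟩⟩ := hn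
  · by_cases hnj : K.cluster n = j
    · exact Or.inl hnj
    · exact Or.inr ⟨hnj, m, hadj.symm, h⟩
  · exact Or.inl h

/-- Sub-matrix of a network matrix at the extended cluster `a`. -/
def sub (a : Fin Na) (V : Matrix (Fin (N + 1)) (Fin (N + 1)) ℂ) :
    Matrix (K.ext a) (K.ext a) ℂ :=
  V.submatrix (fun n => n.1) (fun n => n.1)

/-- For a matrix `X` of the extended cluster `a`: its sub-matrix `X_j` at the end points of the line
that connects `a` with `j`. -/
def own (a j : Fin Na) (X : Matrix (K.ext a) (K.ext a) ℂ) : Matrix (K.tie a j) (K.tie a j) ℂ :=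
  X.submatrix (fun n => ⟨n.1, K.tie_subset_left a j n.2⟩) (fun n => ⟨n.1, K.tie_subset_left a j n.2⟩)

/-- For a matrix `X` of the extended cluster `j`: its sub-matrix `X_a` at the end points of the line
that connects `a` with `j`. -/
def other (a j : Fin Na) (X : Matrix (K.ext j) (K.ext j) ℂ) : Matrix (K.tie a j) (K.tie a j) ℂ :=
  X.submatrix (fun n => ⟨n.1, K.tie_subset_right a j n.2⟩)
    (fun n => ⟨n.1, K.tie_subset_right a j n.2⟩)

end Clustering

/-- Costs of the dispatch problem: utility cost `C_utility(V, p)`, regularization weight `λ`, customer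
costs `R_h`, and the costs `C^a(V^a, p^a)` and weights `λ^a` of the clusters. -/
structure Costs {N Na : ℕ} {F : Feeder N} (K : Clustering F Na) where
  Cutil : Matrix (Fin (N + 1)) (Fin (N + 1)) ℂ → (F.H → ℝ) → ℝ
  lam : ℝ
  R : F.H → ℝ → ℝ
  C : (a : Fin Na) → Matrix (K.ext a) (K.ext a) ℂ → (K.Houses a → ℝ) → ℝ
  lamC : Fin Na → ℝ

/-- `x` solves the problem of minimizing `f` over `s`. -/
def IsSolution {E : Type*} (f : E → ℝ) (s : Set E) (x : E) : Prop := x ∈ s ∧ IsMinOn f s x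

namespace Costs

variable {N Na : ℕ} {F : Feeder N} {K : Clustering F Na} (D : Costs K)

/-! ### The centralized relaxed problem -/

/-- Variables `(V, p, q)`. -/
abbrev CentralVar (_D : Costs K) : Type :=
  Matrix (Fin (N + 1)) (Fin (N + 1)) ℂ × (F.H → ℝ) × (F.H → ℝ)

def centralCost : D.CentralVar → ℝ := fun ⟨V, p, q⟩ =>
  (D.Cutil V p + ∑ h, D.R h (p h)) + D.lam * ∑ h, Real.sqrt (p h ^ 2 + q h ^ 2)

def centralFeasible : Set D.CentralVar := {x | match x with
  | ⟨V, p, q⟩ =>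
    V.PosSemidef ∧
    (∀ h : F.H, (F.A h * V).trace = ((-F.Pl h + F.Pav h - p h : ℝ) : ℂ)) ∧
    (∀ h : F.H, (F.B h * V).trace = ((-F.Ql h + q h : ℝ) : ℂ)) ∧
    (∀ n ∈ F.U, (F.A n * V).trace = 0 ∧ (F.B n * V).trace = 0) ∧
    (∀ n, F.Vmin ^ 2 ≤ (F.M n * V).trace.re ∧ (F.M n * V).trace.re ≤ F.Vmax ^ 2) ∧
    (∀ h, (p h, q h) ∈ F.region h)}

/-! ### The cluster formulation -/

/-- Regularized cost of cluster `a`. -/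
def Cbar (a : Fin Na) (X : Matrix (K.ext a) (K.ext a) ℂ) (p q : K.Houses a → ℝ) : ℝ :=
  D.C a X p + D.lamC a * ∑ h, Real.sqrt (p h ^ 2 + q h ^ 2)

/-- Feasible power flows of cluster `a`. -/
def flows (_D : Costs K) (a : Fin Na) :
    Set (Matrix (K.ext a) (K.ext a) ℂ × (K.Houses a → ℝ) × (K.Houses a → ℝ)) := {x | match x with
  | ⟨X, p, q⟩ =>
    (∀ h : K.Houses a, (K.sub a (F.A h.1) * X).trace = ((-F.Pl h.1 + F.Pav h.1 - p h : ℝ) : ℂ)) ∧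
    (∀ h : K.Houses a, (K.sub a (F.B h.1) * X).trace = ((-F.Ql h.1 + q h : ℝ) : ℂ)) ∧
    (∀ n ∈ F.U, K.cluster n = a →
      (K.sub a (F.A n) * X).trace = 0 ∧ (K.sub a (F.B n) * X).trace = 0) ∧
    (∀ n, K.cluster n = a → F.Vmin ^ 2 ≤ (K.sub a (F.M n) * X).trace.re ∧
      (K.sub a (F.M n) * X).trace.re ≤ F.Vmax ^ 2)}

/-- Variables `(V, p, q, pbar, qbar)`. -/
abbrev ClusterVar (_D : Costs K) : Type :=
  Matrix (Fin (N + 1)) (Fin (N + 1)) ℂ × (F.H → ℝ) × (F.H → ℝ) × (F.H → ℝ) × (F.H → ℝ)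

def clusterCost : D.ClusterVar → ℝ := fun ⟨V, p, _q, pbar, qbar⟩ =>
  ∑ a, (D.Cbar a (K.sub a V) (fun h => pbar h.1) (fun h => qbar h.1) +
    ∑ h : K.Houses a, D.R h.1 (p h.1))

def clusterFeasible : Set D.ClusterVar := {x | match x with
  | ⟨V, p, q, pbar, qbar⟩ =>
    V.PosSemidef ∧
    (∀ a, (K.sub a V, (fun h => pbar h.1), (fun h => qbar h.1)) ∈ D.flows a) ∧
    (∀ h, (p h, q h) ∈ F.region h) ∧
    (∀ h, pbar h = p h ∧ qbar h = q h)}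

/-! ### The algorithm -/

end Costs

/-- One iterate: cluster voltages `V^a`, copies `pbar, qbar` of the setpoints at the cluster energy
managers, customer setpoints `p, q`, and the multipliers. -/
structure Iterate {N Na : ℕ} {F : Feeder N} (K : Clustering F Na) where
  V : (a : Fin Na) → Matrix (K.ext a) (K.ext a) ℂ
  pbar : F.H → ℝ
  qbar : F.H → ℝ
  p : F.H → ℝ
  q : F.H → ℝ
  γ : F.H → ℝ
  μ : F.H → ℝ
  Υ : (a j : Fin Na) → Matrix (K.tie a j) (K.tie a j) ℝ
  Ψ : (a j : Fin Na) → Matrix (K.tie a j) (K.tie a j) ℝ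

namespace Costs

variable {N Na : ℕ} {F : Feeder N} {K : Clustering F Na} (D : Costs K)

/-- Objective of customer `h`, given the current iterate `s`. -/
def customerCost (κ : ℝ) (s : Iterate K) (h : F.H) : ℝ × ℝ → ℝ := fun ⟨P, Q⟩ =>
  D.R h P + κ / 2 * (P ^ 2 + Q ^ 2)
    - P * (s.γ h + κ / 2 * s.pbar h + κ / 2 * s.p h)
    - Q * (s.μ h + κ / 2 * s.qbar h + κ / 2 * s.q h)

/-- Variables `(V^a, pbar^a, qbar^a, α, β)` of the energy manager of cluster `a`. -/
abbrev ManagerVar (_D : Costs K) (a : Fin Na) : Type :=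
  Matrix (K.ext a) (K.ext a) ℂ × (K.Houses a → ℝ) × (K.Houses a → ℝ) ×
    (K.nbr a → ℝ) × (K.nbr a → ℝ)

/-- The matrix `V^a_j - (V^a_j[i] + V^j_a[i]) / 2`. -/
def deviation (_D : Costs K) (s : Iterate K) (a j : Fin Na) (X : Matrix (K.ext a) (K.ext a) ℂ) :
    Matrix (K.tie a j) (K.tie a j) ℂ :=
  K.own a j X - (1 / 2 : ℂ) • (K.own a j (s.V a) + K.other a j (s.V j))

/-- The linear matrix inequality `[-t, vᵀ; v, -I] ⪯ 0`. -/
def SchurLMI {ι : Type*} [Fintype ι] [DecidableEq ι] (t : ℝ) (v : ι → ℝ) : Prop :=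
  (-(Matrix.fromBlocks (Matrix.of fun _ _ => -t) (Matrix.replicateRow Unit v)
    (Matrix.replicateCol Unit v) (-1) : Matrix (Unit ⊕ ι) (Unit ⊕ ι) ℝ)).PosSemidef

/-- Objective of the energy manager of cluster `a`, given the current iterate `s`: regularized cost,
consensus terms for the setpoints, and consensus terms for the tie-line voltages. -/
def managerCost (κ : ℝ) (s : Iterate K) (a : Fin Na) : D.ManagerVar a → ℝ :=
  fun ⟨X, pbar, qbar, α, β⟩ =>
    D.Cbar a X pbar qbar +
    ∑ h : K.Houses a, (κ / 2 * (pbar h ^ 2 + qbar h ^ 2)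
      + pbar h * (s.γ h.1 - κ / 2 * s.pbar h.1 - κ / 2 * s.p h.1)
      + qbar h * (s.μ h.1 - κ / 2 * s.qbar h.1 - κ / 2 * s.q h.1)) +
    ∑ j : K.nbr a, (κ / 2 * (α j + β j)
      + ((s.Υ a j)ᵀ * (K.own a j X).map Complex.re).trace
      + ((s.Ψ a j)ᵀ * (K.own a j X).map Complex.im).trace)

def managerFeasible (s : Iterate K) (a : Fin Na) : Set (D.ManagerVar a) := {x | match x with
  | ⟨X, pbar, qbar, α, β⟩ =>
    (X, pbar, qbar) ∈ D.flows a ∧ X.PosSemidef ∧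
    (∀ j : K.nbr a, 0 ≤ α j ∧ 0 ≤ β j ∧
      SchurLMI (α j) (fun mn : K.tie a j × K.tie a j => (D.deviation s a j X mn.1 mn.2).re) ∧
      SchurLMI (β j) (fun mn : K.tie a j × K.tie a j => (D.deviation s a j X mn.1 mn.2).im))}

/-- One round of the multi-cluster algorithm leads from the iterate `s` to the iterate `s'`. -/
structure Step (κ : ℝ) (s s' : Iterate K) : Prop where
  customer : ∀ h, IsSolution (D.customerCost κ s h) (F.region h) (s'.p h, s'.q h)
  manager : ∀ a, ∃ α β, IsSolution (D.managerCost κ s a) (D.managerFeasible s a)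
    (s'.V a, (fun h => s'.pbar h.1), (fun h => s'.qbar h.1), α, β)
  dual_p : ∀ h, s'.γ h = s.γ h + κ / 2 * (s'.pbar h - s'.p h)
  dual_q : ∀ h, s'.μ h = s.μ h + κ / 2 * (s'.qbar h - s'.q h)
  dual_re : ∀ a, ∀ j ∈ K.nbr a, s'.Υ a j = s.Υ a j + (κ / 2) •
    ((K.own a j (s'.V a)).map Complex.re - (K.other a j (s'.V j)).map Complex.re)
  dual_im : ∀ a, ∀ j ∈ K.nbr a, s'.Ψ a j = s.Ψ a j + (κ / 2) •
    ((K.own a j (s'.V a)).map Complex.im - (K.other a j (s'.V j)).map Complex.im)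

/-- A run of the algorithm: the multipliers start at zero, the setpoints and voltages anywhere. -/
structure IsRun (κ : ℝ) (x : ℕ → Iterate K) : Prop where
  init_p : ∀ h, (x 0).γ h = 0
  init_q : ∀ h, (x 0).μ h = 0
  init_re : ∀ a, ∀ j ∈ K.nbr a, (x 0).Υ a j = 0
  init_im : ∀ a, ∀ j ∈ K.nbr a, (x 0).Ψ a j = 0
  step : ∀ i, D.Step κ (x i) (x (i + 1))

/-! ### Standing assumptions -/

/-- The network-related cost decouples across the clusters. -/
def Decoupled : Prop :=
  ∀ V : Matrix (Fin (N + 1)) (Fin (N + 1)) ℂ, V.PosSemidef → ∀ p q : F.H → ℝ,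
    D.Cutil V p + D.lam * ∑ h, Real.sqrt (p h ^ 2 + q h ^ 2) =
      ∑ a, D.Cbar a (K.sub a V) (fun h => p h.1) (fun h => q h.1)

/-- Slater's condition for the relaxed problem: some feasible point is strictly feasible for the
constraints that are not polyhedral. -/
def StrictlyFeasible : Prop :=
  ∃ V p q, (V, p, q) ∈ D.centralFeasible ∧ V.PosDef ∧
    ∀ h, q h ^ 2 < F.S h ^ 2 - (F.Pav h - p h) ^ 2

/-- The cluster voltages of an optimal solution of the cluster formulation are determined by the
setpoints and by the voltages on the lines between clusters. -/
def VoltagesDetermined : Prop :=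
  ∀ (V V' : Matrix (Fin (N + 1)) (Fin (N + 1)) ℂ) (p q : F.H → ℝ),
    IsSolution D.clusterCost D.clusterFeasible (V, p, q, p, q) →
    IsSolution D.clusterCost D.clusterFeasible (V', p, q, p, q) →
    (∀ a, ∀ j ∈ K.nbr a, K.own a j (K.sub a V) = K.own a j (K.sub a V')) →
    ∀ a, K.sub a V = K.sub a V'

end Costs

end OID

end

open Filter Topology Matrix
open scoped ComplexOrder

noncomputable section

namespace OID

/-! The algorithm is an alternating direction method of multipliers in disguise. Put the primal
variables of all customers and managers into one point x, and let L x (`Clustering.reading`) list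
every exchanged quantity once for each of its two owners. An involution σ (`Clustering.swap`)
exchanges the two entries, and consensus means that L x is σ-invariant. The customer and manager
problems together minimize f(x) + ⟨y, L x⟩ + κ/2 ‖L x − z‖² (`Costs.augmented_eq`,
`Costs.Step.augmented_le`), where z averages the previous readings over σ; the multiplier y stays
antisymmetric under σ.

Convergence (`consensus_admm`) rests on ‖y − y*‖²/κ² + ‖z − z*‖², which for every saddle point drops
in each round by at least the same expression for the increments of (y, z) (`lyapunov_step`). So the
increments tend to zero, the iterates stay bounded, and an ultrafilter limit is again a saddle
point; measured from that limit the distance tends to zero, so y and L x converge. The cluster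
voltages are not determined by L x: only their limit points are controlled, until
`Costs.VoltagesDetermined` leaves a single one.

A saddle point exists by Slater's condition (`exists_lagrange_multiplier`): Hahn–Banach treats the
constraints that are not polyhedral, which have an interior point, and Farkas' lemma treats the
polyhedral ones, which may have none.

The tree enters in `Clustering.exists_completion`. Positive semidefinite cluster matrices are Gram
matrices; agreement on a tie lets the vectors of one cluster be moved isometrically onto those of
its neighbour, and without cycles these motions never conflict. Hence consensus points of the joint
problem are the images of feasible points of the centralized problem (`Costs.exists_embed`). -/

/-! ### Farkas' lemma and polyhedra -/

/-- Farkas' lemma for finitely many linear functionals on a real vector space. -/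
theorem farkas {W ι : Type*} [AddCommGroup W] [Module ℝ W] (s : Finset ι) :
    ∀ (A : ι → W →ₗ[ℝ] ℝ) (b : W →ₗ[ℝ] ℝ), (∀ x, (∀ i ∈ s, A i x ≤ 0) → b x ≤ 0) →
      ∃ u : ι → ℝ, (∀ i ∈ s, 0 ≤ u i) ∧ ∀ x, b x = ∑ i ∈ s, u i * A i x := by
  classical
  induction s using Finset.induction_on with
  | empty =>
    intro A b h
    refine ⟨0, by simp, fun x => ?_⟩
    have h1 := h x (by simp)
    have h2 := h (-x) (by simp)
    rw [map_neg] at h2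
    simp only [Finset.sum_empty]
    linarith
  | insert m s hm ih =>
    intro A b h
    by_cases hc : ∀ x, (∀ i ∈ s, A i x ≤ 0) → b x ≤ 0
    · obtain ⟨u, hu, hb⟩ := ih A b hc
      refine ⟨Function.update u m 0, fun i hi => ?_, fun x => ?_⟩
      · by_cases him : i = m
        · simp [him]
        · simpa [Function.update_of_ne him] using hu i ((Finset.mem_insert.1 hi).resolve_left him)
      · rw [hb x, Finset.sum_insert hm]
        simp only [Function.update_self, zero_mul, zero_add]
        refine Finset.sum_congr rfl fun i hi => ?_
        rw [Function.update_of_ne (ne_of_mem_of_not_mem hi hm)]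
    · push Not at hc
      obtain ⟨x₀, hx₀, hbx₀⟩ := hc
      have hm0 : 0 < A m x₀ := by
        by_contra hle
        push Not at hle
        exact absurd (h x₀ fun i hi => (Finset.mem_insert.1 hi).elim (fun e => e ▸ hle) (hx₀ i))
          (not_le.2 hbx₀)
      set r := (A m x₀)⁻¹ with hr
      have hr0 : 0 < r := inv_pos.2 hm0
      have hrm : r * A m x₀ = 1 := inv_mul_cancel₀ hm0.ne'
      -- `x₀` shows that inequality `m` cannot be dropped. The induction hypothesis is applied after
      -- the projection x ↦ x − (r · A m x) x₀ onto the kernel of `A m`; the multiplier of `A m`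
      -- then collects the correction terms and is nonnegative by the signs at `x₀`.
      obtain ⟨u, hu, hb⟩ := ih (fun i => A i - (r * A i x₀) • A m) (b - (r * b x₀) • A m) (by
        intro x hx
        have key := h (x - (r * A m x) • x₀) (by
          intro i hi
          rcases Finset.mem_insert.1 hi with rfl | hi
          · simp only [map_sub, map_smul, smul_eq_mul]
            linear_combination (-(A i x)) * hrm
          · have := hx i hi
            simp only [LinearMap.sub_apply, LinearMap.smul_apply, smul_eq_mul] at this
            simp only [map_sub, map_smul, smul_eq_mul]
            linarith)
        simp only [map_sub, map_smul, smul_eq_mul] at key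
        simp only [LinearMap.sub_apply, LinearMap.smul_apply, smul_eq_mul]
        linarith)
      refine ⟨Function.update u m (r * b x₀ - ∑ i ∈ s, u i * (r * A i x₀)), fun i hi => ?_,
        fun x => ?_⟩
      · by_cases him : i = m
        · subst him
          simp only [Function.update_self]
          have : ∑ j ∈ s, u j * (r * A j x₀) ≤ 0 := Finset.sum_nonpos fun j hj =>
            mul_nonpos_of_nonneg_of_nonpos (hu j hj)
              (mul_nonpos_of_nonneg_of_nonpos hr0.le (hx₀ j hj))
          have := mul_pos hr0 hbx₀
          linarith
        · simpa [Function.update_of_ne him] using hu i ((Finset.mem_insert.1 hi).resolve_left him)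
      · have hbx := hb x
        simp only [LinearMap.sub_apply, LinearMap.smul_apply, smul_eq_mul] at hbx
        rw [Finset.sum_insert hm]
        simp only [Function.update_self]
        have e1 : ∑ i ∈ s, Function.update u m (r * b x₀ - ∑ i ∈ s, u i * (r * A i x₀)) i * A i x
            = ∑ i ∈ s, u i * A i x := Finset.sum_congr rfl fun i hi => by
          rw [Function.update_of_ne (ne_of_mem_of_not_mem hi hm)]
        rw [e1, sub_mul, Finset.sum_mul]
        have e2 : ∑ i ∈ s, u i * (A i x - r * A i x₀ * A m x)
            = ∑ i ∈ s, u i * A i x - ∑ i ∈ s, u i * (r * A i x₀) * A m x := by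
          rw [← Finset.sum_sub_distrib]
          exact Finset.sum_congr rfl fun i _ => by ring
        linarith

/-- A set that is described by finitely many linear inequalities. -/
def IsPolyhedral {E : Type*} [AddCommGroup E] [Module ℝ E] (P : Set E) : Prop :=
  ∃ s : Finset ((E →ₗ[ℝ] ℝ) × ℝ), ∀ x, x ∈ P ↔ ∀ c ∈ s, c.1 x ≤ c.2

namespace IsPolyhedral

variable {E : Type*} [AddCommGroup E] [Module ℝ E]

theorem halfspace (l : E →ₗ[ℝ] ℝ) (b : ℝ) : IsPolyhedral {x | l x ≤ b} :=
  ⟨{(l, b)}, by simp⟩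

theorem inter {P Q : Set E} (hP : IsPolyhedral P) (hQ : IsPolyhedral Q) :
    IsPolyhedral (P ∩ Q) := by
  classical
  obtain ⟨s, hs⟩ := hP
  obtain ⟨t, ht⟩ := hQ
  refine ⟨s ∪ t, fun x => ?_⟩
  rw [Set.mem_inter_iff, hs, ht]
  simp only [Finset.mem_union, or_imp, forall_and]

theorem iInter {ι : Type*} [Finite ι] {P : ι → Set E} (hP : ∀ i, IsPolyhedral (P i)) :
    IsPolyhedral (⋂ i, P i) := by
  classical
  cases nonempty_fintype ι
  choose s hs using hP
  refine ⟨Finset.univ.biUnion s, fun x => ?_⟩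
  simp only [Set.mem_iInter, hs, Finset.mem_biUnion, Finset.mem_univ, true_and]
  exact ⟨fun h c ⟨i, hi⟩ => h i c hi, fun h i c hc => h c ⟨i, hc⟩⟩

theorem forall_mem {ι : Type*} [Finite ι] {P : ι → E → Prop} (hP : ∀ i, IsPolyhedral {x | P i x}) :
    IsPolyhedral {x | ∀ i, P i x} := by
  have := iInter hP
  rwa [← Set.ofPred_forall] at this

theorem and {P Q : E → Prop} (hP : IsPolyhedral {x | P x}) (hQ : IsPolyhedral {x | Q x}) :
    IsPolyhedral {x | P x ∧ Q x} := hP.inter hQ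

theorem of_imp {p : Prop} {P : E → Prop} (hP : p → IsPolyhedral {x | P x}) :
    IsPolyhedral {x | p → P x} := by
  by_cases h : p
  · simpa [h] using hP h
  · exact ⟨∅, by simp [h]⟩

theorem le_const {g : E → ℝ} (hg : IsLinearMap ℝ g) (b : ℝ) : IsPolyhedral {x | g x ≤ b} :=
  halfspace (hg.mk' g) b

theorem const_le {g : E → ℝ} (hg : IsLinearMap ℝ g) (b : ℝ) : IsPolyhedral {x | b ≤ g x} := by
  have := halfspace (-(hg.mk' g)) (-b)
  simpa using this

theorem eq_const {g : E → ℝ} (hg : IsLinearMap ℝ g) (b : ℝ) : IsPolyhedral {x | g x = b} := by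
  have := (le_const hg b).and (const_le hg b)
  simpa [le_antisymm_iff] using this

theorem convex {P : Set E} (hP : IsPolyhedral P) : Convex ℝ P := by
  obtain ⟨s, hs⟩ := hP
  intro x hx y hy a b ha hb hab
  rw [hs] at hx hy ⊢
  intro c hc
  simp only [map_add, map_smul, smul_eq_mul]
  calc a * c.1 x + b * c.1 y ≤ a * c.2 + b * c.2 :=
        add_le_add (mul_le_mul_of_nonneg_left (hx c hc) ha) (mul_le_mul_of_nonneg_left (hy c hc) hb)
    _ = c.2 := by rw [← add_mul, hab, one_mul]

/-- Multipliers for the equality constraints of a linear program. -/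
theorem exists_multiplier {ι : Type*} [Fintype ι] {P : Set E} (hP : IsPolyhedral P)
    (L : ι → E →ₗ[ℝ] ℝ) (g : E →ₗ[ℝ] ℝ) {x₀ : E} (hx₀ : x₀ ∈ P) (hL₀ : ∀ i, L i x₀ = 0)
    (hmin : ∀ x ∈ P, (∀ i, L i x = 0) → g x₀ ≤ g x) :
    ∃ c : ι → ℝ, ∀ x ∈ P, g x₀ ≤ g x + ∑ i, c i * L i x := by
  classical
  obtain ⟨s, hs⟩ := hP
  -- Only constraints active at `x₀` carry multipliers, and each equality enters as the two
  -- inequalities for `L i` and `-L i`. A direction allowed by all of these keeps short steps from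
  -- `x₀` feasible, because inactive constraints have slack.
  set act := s.filter fun c => c.1 x₀ = c.2 with hact
  let A : ((E →ₗ[ℝ] ℝ) × ℝ) ⊕ (ι ⊕ ι) → E →ₗ[ℝ] ℝ :=
    Sum.elim (fun c => c.1) (Sum.elim L fun i => -L i)
  obtain ⟨u, hu, hg⟩ := farkas (act.disjSum (Finset.univ.disjSum Finset.univ)) A (-g) (by
    intro d hd
    have hact_d : ∀ c ∈ act, c.1 d ≤ 0 := fun c hc => hd (Sum.inl c) (by simpa using hc)
    have hLd : ∀ i, L i d = 0 := fun i => le_antisymm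
      (hd (Sum.inr (Sum.inl i)) (by simp))
      (by simpa [A] using hd (Sum.inr (Sum.inr i)) (by simp))
    have hev : ∀ᶠ ε : ℝ in 𝓝[>] 0, ∀ c ∈ s, c.1 (x₀ + ε • d) ≤ c.2 := by
      rw [Filter.eventually_all_finset]
      intro c hc
      by_cases hca : c.1 x₀ = c.2
      · filter_upwards [self_mem_nhdsWithin] with ε hε
        have := mul_nonpos_of_nonneg_of_nonpos (le_of_lt hε) (hact_d c (by simp [hact, hc, hca]))
        simp only [map_add, map_smul, smul_eq_mul]
        linarith
      · have hlt : c.1 x₀ < c.2 := lt_of_le_of_ne ((hs x₀).1 hx₀ c hc) hca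
        have hcont : Continuous fun ε : ℝ => c.1 x₀ + ε * c.1 d := by fun_prop
        have : ∀ᶠ ε : ℝ in 𝓝 0, c.1 x₀ + ε * c.1 d < c.2 :=
          (hcont.tendsto 0).eventually (gt_mem_nhds (by simpa using hlt))
        filter_upwards [nhdsWithin_le_nhds this] with ε hε
        simpa only [map_add, map_smul, smul_eq_mul] using hε.le
    obtain ⟨ε, hε, hε0⟩ := (hev.and self_mem_nhdsWithin).exists
    have := hmin (x₀ + ε • d) ((hs _).2 hε) fun i => by simp [hL₀ i, hLd i]
    simp only [map_add, map_smul, smul_eq_mul] at this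
    have h0 : 0 ≤ ε * g d := by linarith
    simpa using nonneg_of_mul_nonneg_right h0 hε0)
  refine ⟨fun i => u (Sum.inr (Sum.inl i)) - u (Sum.inr (Sum.inr i)), fun x hx => ?_⟩
  have hgx := hg (x - x₀)
  simp only [Finset.sum_disjSum, A, Sum.elim_inl, Sum.elim_inr, LinearMap.neg_apply, map_sub,
    hL₀, neg_zero, sub_zero] at hgx
  have h1 : ∑ c ∈ act, u (Sum.inl c) * (c.1 x - c.1 x₀) ≤ 0 := by
    refine Finset.sum_nonpos fun c hc => mul_nonpos_of_nonneg_of_nonpos (hu _ (by simpa using hc)) ?_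
    have hc' := Finset.mem_filter.1 hc
    have := (hs x).1 hx c hc'.1
    linarith [hc'.2]
  have h2 : ∑ i, (u (Sum.inr (Sum.inl i)) - u (Sum.inr (Sum.inr i))) * L i x
      = ∑ i, u (Sum.inr (Sum.inl i)) * L i x + ∑ i, u (Sum.inr (Sum.inr i)) * -L i x := by
    rw [← Finset.sum_add_distrib]
    exact Finset.sum_congr rfl fun i _ => by ring
  rw [h2]
  linarith

end IsPolyhedral

/-- Lagrange multipliers for linear equality constraints of a convex program, when the remaining
constraints are polyhedral except for a convex set with an interior point that is feasible. -/
theorem exists_lagrange_multiplier {E ι : Type*} [AddCommGroup E] [Module ℝ E] [TopologicalSpace E]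
    [IsTopologicalAddGroup E] [ContinuousSMul ℝ E] [Fintype ι] {f : E → ℝ}
    (hf : ConvexOn ℝ Set.univ f) (hfc : Continuous f) {S P : Set E} (hS : Convex ℝ S)
    (hP : IsPolyhedral P) (L : ι → E →ₗ[ℝ] ℝ) {x₀ x₁ : E} (h₁ : x₁ ∈ interior S) (h₁P : x₁ ∈ P)
    (h₁L : ∀ i, L i x₁ = 0) (h₀ : x₀ ∈ S) (h₀P : x₀ ∈ P) (h₀L : ∀ i, L i x₀ = 0)
    (hmin : ∀ x ∈ S ∩ P, (∀ i, L i x = 0) → f x₀ ≤ f x) :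
    ∃ c : ι → ℝ, ∀ x ∈ S ∩ P, f x₀ ≤ f x + ∑ i, c i * L i x := by
  -- The strict epigraph over the interior of `S` is separated from the rest. The polyhedral
  -- constraints stay on the side of `B`, where no interior is needed.
  let A : Set (E × ℝ) := {z | z.1 ∈ interior S ∧ f z.1 < z.2}
  let B : Set (E × ℝ) := {z | (z.1 ∈ P ∧ ∀ i, L i z.1 = 0) ∧ z.2 ≤ f x₀}
  have hA : Convex ℝ A := by
    rintro ⟨x, s⟩ ⟨hx, hxs⟩ ⟨y, t⟩ ⟨hy, hyt⟩ a b ha hb hab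
    refine ⟨hS.interior hx hy ha hb hab, ?_⟩
    refine (hf.2 (Set.mem_univ x) (Set.mem_univ y) ha hb hab).trans_lt ?_
    simp only [smul_eq_mul, Prod.smul_mk, Prod.mk_add_mk] at hxs hyt ⊢
    rcases ha.eq_or_lt with rfl | ha
    · have hb1 : b = 1 := by linarith
      subst hb1; linarith
    · have := mul_lt_mul_of_pos_left hxs ha
      have := mul_le_mul_of_nonneg_left hyt.le hb
      linarith
  have hAo : IsOpen A := (isOpen_interior.preimage continuous_fst).inter
    (isOpen_lt (hfc.comp continuous_fst) continuous_snd)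
  have hB : Convex ℝ B := by
    rintro ⟨x, s⟩ ⟨⟨hx, hxL⟩, hxs⟩ ⟨y, t⟩ ⟨⟨hy, hyL⟩, hyt⟩ a b ha hb hab
    refine ⟨⟨hP.convex hx hy ha hb hab, fun i => ?_⟩, ?_⟩
    · simp_all
    · simp only [smul_eq_mul, Prod.smul_mk, Prod.mk_add_mk] at hxs hyt ⊢
      have := mul_le_mul_of_nonneg_left hxs ha
      have := mul_le_mul_of_nonneg_left hyt hb
      have : a * f x₀ + b * f x₀ = f x₀ := by rw [← add_mul, hab, one_mul]
      linarith
  have hdisj : Disjoint A B := by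
    rw [Set.disjoint_left]
    rintro ⟨x, s⟩ ⟨hx, hxs⟩ ⟨⟨hxP, hxL⟩, hxf⟩
    exact absurd (hmin x ⟨interior_subset hx, hxP⟩ hxL) (not_le.2 (hxs.trans_le hxf))
  obtain ⟨φ, u, hφA, hφB⟩ := geometric_hahn_banach_open hA hAo hB hdisj
  set s := φ (0, 1) with hs
  have hdec : ∀ x t, φ (x, t) = φ (x, 0) + t * s := by
    intro x t
    have : ((x, t) : E × ℝ) = (x, 0) + t • (0, 1) := by simp
    rw [this, map_add, map_smul, smul_eq_mul]
  -- The Slater point `x₁` lies under both sets, so the separating hyperplane is not vertical.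
  have hs0 : s < 0 := by
    have h1 := hφA (x₁, f x₁ + 1) ⟨h₁, by simp⟩
    have h2 := hφB (x₁, f x₀) ⟨⟨h₁P, h₁L⟩, le_rfl⟩
    rw [hdec] at h1 h2
    have h3 := hmin x₁ ⟨interior_subset h₁, h₁P⟩ h₁L
    by_contra hs0
    push Not at hs0
    nlinarith
  have hr0 : 0 < (-s)⁻¹ := inv_pos.2 (neg_pos.2 hs0)
  -- After normalization, `g` lies below `f` plus a constant on `S` and above `f x₀` plus that
  -- constant on the polyhedral feasible set, with equality at `x₀`. So `x₀` solves a linear program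
  -- with objective `g`, and its multipliers serve for `f`.
  let g : E →ₗ[ℝ] ℝ := (-s)⁻¹ • (φ.toLinearMap ∘ₗ LinearMap.inl ℝ E ℝ)
  have hg : ∀ x, g x = (-s)⁻¹ * φ (x, 0) := fun x => rfl
  have hrs : (-s)⁻¹ * s = -1 := by rw [inv_neg, neg_mul, inv_mul_cancel₀ hs0.ne]
  have hQ : ∀ x ∈ P, (∀ i, L i x = 0) → (-s)⁻¹ * u + f x₀ ≤ g x := by
    intro x hx hxL
    have := hφB (x, f x₀) ⟨⟨hx, hxL⟩, le_rfl⟩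
    rw [hdec] at this
    have := mul_le_mul_of_nonneg_left this hr0.le
    rw [hg]
    linear_combination this + f x₀ * hrs
  have hI : ∀ x ∈ interior S, g x ≤ (-s)⁻¹ * u + f x := by
    intro x hx
    refine le_of_forall_pos_le_add fun ε hε => ?_
    have := hφA (x, f x + ε) ⟨hx, by simpa using hε⟩
    rw [hdec] at this
    have := mul_le_mul_of_nonneg_left this.le hr0.le
    rw [hg]
    linear_combination this + (-f x - ε) * hrs
  have hS' : ∀ x ∈ S, g x ≤ (-s)⁻¹ * u + f x := by
    intro x hx
    have hseg : ∀ t ∈ Set.Ioc (0 : ℝ) 1, g (x + t • (x₁ - x)) ≤ (-s)⁻¹ * u + f (x + t • (x₁ - x)) :=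
      fun t ht => hI _ (hS.add_smul_sub_mem_interior hx h₁ ht)
    have hgc : Continuous fun t : ℝ => g (x + t • (x₁ - x)) := by
      simp only [map_add, map_smul, smul_eq_mul]; fun_prop
    have hfc' : Continuous fun t : ℝ => (-s)⁻¹ * u + f (x + t • (x₁ - x)) := by fun_prop
    have := le_of_tendsto_of_tendsto
      ((hgc.tendsto 0).mono_left (nhdsWithin_le_nhds (s := Set.Ioi 0)))
      ((hfc'.tendsto 0).mono_left (nhdsWithin_le_nhds (s := Set.Ioi 0)))
      (by
        filter_upwards [Ioc_mem_nhdsGT (zero_lt_one' ℝ)] with t ht using hseg t ht)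
    simpa using this
  have hg₀ : g x₀ = (-s)⁻¹ * u + f x₀ := le_antisymm (hS' x₀ h₀) (hQ x₀ h₀P h₀L)
  obtain ⟨c, hc⟩ := hP.exists_multiplier L g h₀P h₀L fun x hx hxL => by
    rw [hg₀]; exact hQ x hx hxL
  refine ⟨c, fun x hx => ?_⟩
  have h1 := hc x hx.2
  have h2 := hS' x hx.1
  linarith

/-! ### Convergence of the alternating direction method for a consensus constraint -/

/-- First-order optimality condition for a convex function plus a quadratic function of finitely
many linear functionals. -/
theorem variational_inequality {E ι : Type*} [AddCommGroup E] [Module ℝ E] [Fintype ι] {f : E → ℝ}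
    {S : Set E} (hf : ConvexOn ℝ S f) (L : E →ₗ[ℝ] ι → ℝ) (y z : ι → ℝ) (κ : ℝ) {x : E}
    (hx : x ∈ S)
    (hmin : ∀ v ∈ S, f x + ∑ i, y i * L x i + κ / 2 * ∑ i, (L x i - z i) ^ 2 ≤
      f v + ∑ i, y i * L v i + κ / 2 * ∑ i, (L v i - z i) ^ 2) :
    ∀ v ∈ S, f x + ∑ i, (y i + κ * (L x i - z i)) * (L x i - L v i) ≤ f v := by
  intro v hv
  set a := f v - f x - ∑ i, (y i + κ * (L x i - z i)) * (L x i - L v i) with ha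
  set b := κ / 2 * ∑ i, (L v i - L x i) ^ 2 with hb
  suffices h : 0 ≤ a by linarith
  -- Compare `x` with (1 − t) x + t v and divide by t; `b` is the second-order remainder, which
  -- vanishes as t → 0.
  have key : ∀ t ∈ Set.Ioc (0 : ℝ) 1, 0 ≤ a + t * b := by
    rintro t ⟨ht0, ht1⟩
    have hw := hf.1 hx hv (sub_nonneg.2 ht1) ht0.le (sub_add_cancel 1 t)
    have hfw := hf.2 hx hv (sub_nonneg.2 ht1) ht0.le (sub_add_cancel 1 t)
    have hm := hmin _ hw
    have hL : ∀ i, L ((1 - t) • x + t • v) i = L x i + t * (L v i - L x i) := fun i => by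
      simp only [map_add, map_smul, Pi.add_apply, Pi.smul_apply, smul_eq_mul]; ring
    simp only [smul_eq_mul] at hfw
    have e1 : ∑ i, y i * L ((1 - t) • x + t • v) i
        + κ / 2 * ∑ i, (L ((1 - t) • x + t • v) i - z i) ^ 2
        - (∑ i, y i * L x i + κ / 2 * ∑ i, (L x i - z i) ^ 2)
        = t * (-∑ i, (y i + κ * (L x i - z i)) * (L x i - L v i) + t * b) := by
      simp only [hL, hb, Finset.mul_sum, ← Finset.sum_add_distrib, ← Finset.sum_sub_distrib,
        ← Finset.sum_neg_distrib]
      exact Finset.sum_congr rfl fun i _ => by ring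
    have h0 : 0 ≤ t * (a + t * b) := by
      have : t * (a + t * b) = t * (f v - f x)
        + t * (-∑ i, (y i + κ * (L x i - z i)) * (L x i - L v i) + t * b) := by rw [ha]; ring
      rw [this, ← e1]
      linarith
    exact nonneg_of_mul_nonneg_right h0 ht0
  have hc : Continuous fun t : ℝ => a + t * b := by fun_prop
  have := ge_of_tendsto ((hc.tendsto 0).mono_left (nhdsWithin_le_nhds (s := Set.Ioi 0)))
    (by filter_upwards [Ioc_mem_nhdsGT (zero_lt_one' ℝ)] with t ht using key t ht)
  simpa using this

section Consensus

variable {ι : Type*} [Fintype ι]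

/-- Distance of a pair of multipliers and consensus values to a reference pair. -/
def lyapunov (κ : ℝ) (y z ys zs : ι → ℝ) : ℝ :=
  ∑ i, ((y i - ys i) ^ 2 / κ ^ 2 + (z i - zs i) ^ 2)

theorem lyapunov_nonneg (κ : ℝ) (y z ys zs : ι → ℝ) : 0 ≤ lyapunov κ y z ys zs :=
  Finset.sum_nonneg fun _ _ => by positivity

theorem sq_le_lyapunov (κ : ℝ) (y z ys zs : ι → ℝ) (i : ι) :
    (y i - ys i) ^ 2 / κ ^ 2 + (z i - zs i) ^ 2 ≤ lyapunov κ y z ys zs :=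
  Finset.single_le_sum (f := fun i => (y i - ys i) ^ 2 / κ ^ 2 + (z i - zs i) ^ 2)
    (fun _ _ => by positivity) (Finset.mem_univ i)

/-- One round decreases the distance to every saddle point. -/
theorem lyapunov_step {κ : ℝ} (hκ : 0 < κ) {σ : ι → ι} (hσ : Function.Involutive σ)
    {y z u y' z' ys zs : ι → ℝ} (hy : ∀ i, y (σ i) = -y i) (hz : ∀ i, z (σ i) = z i)
    (hys : ∀ i, ys (σ i) = -ys i) (hzs : ∀ i, zs (σ i) = zs i)
    (hy' : ∀ i, y' i = y i + κ / 2 * (u i - u (σ i))) (hz' : ∀ i, z' i = (u i + u (σ i)) / 2)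
    (h : ∑ i, ((y i + κ * (u i - z i)) * (u i - zs i) - ys i * u i) ≤ 0) :
    lyapunov κ y' z' ys zs + lyapunov κ y' z' y z ≤ lyapunov κ y z ys zs := by
  set G : ι → ℝ := fun i => (y i + κ * (u i - z i)) * (u i - zs i) - ys i * u i with hG
  have hsum : ∑ i, G (σ i) = ∑ i, G i := Equiv.sum_comp (hσ.toPerm σ) G
  have h2 : ∑ i, (G i + G (σ i)) ≤ 0 := by rw [Finset.sum_add_distrib, hsum]; linarith
  -- Pairing the terms at `i` and `σ i` cancels the cross terms and leaves an exact identity, not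
  -- just an estimate.
  have hpt : ∀ i, G i + G (σ i) = κ * (((y' i - ys i) ^ 2 / κ ^ 2 + (z' i - zs i) ^ 2)
      + ((y' i - y i) ^ 2 / κ ^ 2 + (z' i - z i) ^ 2)
      - ((y i - ys i) ^ 2 / κ ^ 2 + (z i - zs i) ^ 2)) := by
    intro i
    simp only [hG, hy, hz, hys, hzs, hy', hz']
    field_simp
    ring
  simp only [hpt, ← Finset.mul_sum, Finset.sum_sub_distrib, Finset.sum_add_distrib] at h2
  simp only [lyapunov, Finset.sum_add_distrib]
  have := nonpos_of_mul_nonpos_right h2 hκ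
  linarith

/-- Convergence of the alternating direction method of multipliers for minimizing a convex function
`f` over a closed convex set `S` subject to the consensus constraint `L x i = L x (σ i)`, where
the multipliers are antisymmetric under the involution `σ`. -/
theorem consensus_admm {E : Type*} [AddCommGroup E] [Module ℝ E] [TopologicalSpace E]
    {f : E → ℝ} {S : Set E} (hf : ConvexOn ℝ S f) (hfc : ContinuousOn f S) (hS : IsClosed S)
    (L : E →ₗ[ℝ] ι → ℝ) (hL : Continuous L)
    {κ : ℝ} (hκ : 0 < κ) {σ : ι → ι} (hσ : Function.Involutive σ)
    (hcpt : ∀ r : ℝ, ∃ Q : Set E, IsCompact Q ∧ ∀ v ∈ S, (∀ i, |L v i| ≤ r) → v ∈ Q)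
    {xs : E} (hxs : xs ∈ S) (hxsL : ∀ i, L xs (σ i) = L xs i)
    {ys : ι → ℝ} (hys : ∀ i, ys (σ i) = -ys i)
    (hsaddle : ∀ v ∈ S, f xs ≤ f v + ∑ i, ys i * L v i)
    (x : ℕ → E) (y : ℕ → ι → ℝ) (hx : ∀ k, x (k + 1) ∈ S)
    (hy0 : ∀ i, y 0 (σ i) = -y 0 i)
    (hy : ∀ k i, y (k + 1) i = y k i + κ / 2 * (L (x (k + 1)) i - L (x (k + 1)) (σ i)))
    (hmin : ∀ k, ∀ v ∈ S,
      f (x (k + 1)) + ∑ i, y k i * L (x (k + 1)) i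
        + κ / 2 * ∑ i, (L (x (k + 1)) i - (L (x k) i + L (x k) (σ i)) / 2) ^ 2 ≤
      f v + ∑ i, y k i * L v i + κ / 2 * ∑ i, (L v i - (L (x k) i + L (x k) (σ i)) / 2) ^ 2) :
    ∃ yl zl : ι → ℝ, Tendsto y atTop (𝓝 yl) ∧ Tendsto (fun k => L (x k)) atTop (𝓝 zl) ∧
      (∀ i, zl (σ i) = zl i) ∧
      ∀ U : Ultrafilter ℕ, (U : Filter ℕ) ≤ atTop → ∀ X, Tendsto x U (𝓝 X) →
        X ∈ S ∧ L X = zl ∧ ∀ v ∈ S, (∀ i, L v (σ i) = L v i) → f X ≤ f v := by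
  -- The average is the consensus variable of the method.
  set z : ℕ → ι → ℝ := fun k i => (L (x k) i + L (x k) (σ i)) / 2 with hz
  have hzσ : ∀ k i, z k (σ i) = z k i := fun k i => by simp only [hz, hσ i]; ring
  have hyσ : ∀ k i, y k (σ i) = -y k i := by
    intro k
    induction k with
    | zero => exact hy0
    | succ k ih => intro i; rw [hy, hy, ih, hσ i]; ring
  have hVI : ∀ k, ∀ v ∈ S, f (x (k + 1))
      + ∑ i, (y k i + κ * (L (x (k + 1)) i - z k i)) * (L (x (k + 1)) i - L v i) ≤ f v :=
    fun k => variational_inequality hf L (y k) (z k) κ (hx k) (hmin k)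
  -- the distance to any saddle point decreases
  have hstep : ∀ (X : E) (Y : ι → ℝ), X ∈ S → (∀ i, L X (σ i) = L X i) → (∀ i, Y (σ i) = -Y i) →
      (∀ v ∈ S, f X ≤ f v + ∑ i, Y i * L v i) → ∀ k,
      lyapunov κ (y (k + 1)) (z (k + 1)) Y (L X) + lyapunov κ (y (k + 1)) (z (k + 1)) (y k) (z k)
        ≤ lyapunov κ (y k) (z k) Y (L X) := by
    intro X Y hX hXL hY hXY k
    refine lyapunov_step hκ hσ (hyσ k) (hzσ k) hY hXL (hy k) (fun _ => rfl) ?_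
    have h1 := hVI k X hX
    have h2 := hXY _ (hx k)
    rw [Finset.sum_sub_distrib]
    linarith
  have hlim : ∀ (X : E) (Y : ι → ℝ), X ∈ S → (∀ i, L X (σ i) = L X i) → (∀ i, Y (σ i) = -Y i) →
      (∀ v ∈ S, f X ≤ f v + ∑ i, Y i * L v i) →
      ∃ l, Tendsto (fun k => lyapunov κ (y k) (z k) Y (L X)) atTop (𝓝 l) := by
    intro X Y hX hXL hY hXY
    refine ⟨_, tendsto_atTop_ciInf (antitone_nat_of_succ_le fun k => ?_)
      ⟨0, by rintro _ ⟨k, rfl⟩; exact lyapunov_nonneg _ _ _ _ _⟩⟩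
    have := hstep X Y hX hXL hY hXY k
    have := lyapunov_nonneg κ (y (k + 1)) (z (k + 1)) (y k) (z k)
    linarith
  -- consequences of a small distance
  have hsmall : ∀ (a b c d : ℕ → ι → ℝ) (l : Filter ℕ),
      Tendsto (fun k => lyapunov κ (a k) (b k) (c k) (d k)) l (𝓝 0) →
      Tendsto (fun k => a k - c k) l (𝓝 0) ∧ Tendsto (fun k => b k - d k) l (𝓝 0) := by
    intro a b c d l h
    have hsq : ∀ (g : ℕ → ℝ), Tendsto (fun k => g k ^ 2) l (𝓝 0) → Tendsto g l (𝓝 0) := by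
      intro g hg
      rw [tendsto_zero_iff_abs_tendsto_zero]
      have := (Real.continuous_sqrt.tendsto 0).comp hg
      simpa [Function.comp_def, Real.sqrt_sq_eq_abs] using this
    constructor
    · rw [tendsto_pi_nhds]
      intro i
      refine hsq _ (squeeze_zero (fun _ => sq_nonneg _) (fun k => ?_)
        (by simpa using h.const_mul (κ ^ 2)))
      have h1 := sq_le_lyapunov κ (a k) (b k) (c k) (d k) i
      have h2 : (a k i - c k i) ^ 2 / κ ^ 2 ≤ lyapunov κ (a k) (b k) (c k) (d k) := by
        have := sq_nonneg (b k i - d k i); linarith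
      rw [div_le_iff₀ (by positivity), mul_comm] at h2
      exact h2
    · rw [tendsto_pi_nhds]
      intro i
      refine hsq _ (squeeze_zero (fun _ => sq_nonneg _) (fun k => ?_) h)
      have h1 := sq_le_lyapunov κ (a k) (b k) (c k) (d k) i
      have : 0 ≤ (a k i - c k i) ^ 2 / κ ^ 2 := by positivity
      simp only [Pi.sub_apply]
      linarith
  obtain ⟨l₀, hl₀⟩ := hlim xs ys hxs hxsL hys hsaddle
  have hdiff : Tendsto (fun k => lyapunov κ (y (k + 1)) (z (k + 1)) (y k) (z k)) atTop (𝓝 0) := by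
    refine squeeze_zero (fun _ => lyapunov_nonneg _ _ _ _ _) (fun k => ?_)
      (by simpa using hl₀.sub (hl₀.comp (tendsto_add_atTop_nat 1)))
    have := hstep xs ys hxs hxsL hys hsaddle k
    linarith
  obtain ⟨hdy, hdz⟩ := hsmall (fun k => y (k + 1)) (fun k => z (k + 1)) y z atTop hdiff
  -- boundedness
  obtain ⟨r, hr⟩ := hl₀.bddAbove_range
  have hr' : ∀ k, lyapunov κ (y k) (z k) ys (L xs) ≤ r := fun k => hr ⟨k, rfl⟩
  have hyb : ∀ k, y k ∈ Set.univ.pi fun i => Set.Icc (ys i - κ * √r) (ys i + κ * √r) := by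
    intro k i _
    have h1 := (sq_le_lyapunov κ (y k) (z k) ys (L xs) i).trans (hr' k)
    have h2 : (y k i - ys i) ^ 2 / κ ^ 2 ≤ r := by nlinarith [sq_nonneg (z k i - L xs i)]
    rw [← div_pow] at h2
    have h3 := Real.abs_le_sqrt h2
    rw [abs_div, abs_of_pos hκ, div_le_iff₀ hκ, mul_comm, abs_le] at h3
    constructor <;> linarith
  have hzb : ∀ k, z k ∈ Set.univ.pi fun i => Set.Icc (L xs i - √r) (L xs i + √r) := by
    intro k i _
    have h1 := (sq_le_lyapunov κ (y k) (z k) ys (L xs) i).trans (hr' k)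
    have h2 : (z k i - L xs i) ^ 2 ≤ r := by
      have : 0 ≤ (y k i - ys i) ^ 2 / κ ^ 2 := by positivity
      linarith
    have h3 := Real.abs_le_sqrt h2
    rw [abs_le] at h3
    constructor <;> linarith
  -- The reading is recovered from `z` and the dual increment. This bounds it, and it shows that the
  -- residual against `z k` tends to zero.
  have hLx : ∀ k, L (x (k + 1)) = z (k + 1) + κ⁻¹ • (y (k + 1) - y k) := by
    intro k
    ext i
    simp only [hz, Pi.add_apply, Pi.smul_apply, Pi.sub_apply, hy, smul_eq_mul]
    field_simp
    ring
  obtain ⟨ρ, hρ⟩ : ∃ ρ : ℝ, ∀ k i, |L (x (k + 1)) i| ≤ ρ := by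
    refine ⟨∑ j, (|ys j| + |L xs j|) + √r + 2 * √r, fun k i => ?_⟩
    have h1 := hzb (k + 1) i (Set.mem_univ i)
    have h2 := hyb (k + 1) i (Set.mem_univ i)
    have h3 := hyb k i (Set.mem_univ i)
    have h4 : |κ⁻¹ * (y (k + 1) i - y k i)| ≤ 2 * √r := by
      rw [abs_mul, abs_of_pos (inv_pos.2 hκ), inv_mul_le_iff₀ hκ, abs_le]
      constructor <;> linarith [h2.1, h2.2, h3.1, h3.2]
    have h5 : |z (k + 1) i| ≤ |L xs i| + √r := by
      rw [abs_le]
      constructor <;> linarith [h1.1, h1.2, neg_abs_le (L xs i), le_abs_self (L xs i)]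
    have h6 := Finset.single_le_sum (f := fun j => |ys j| + |L xs j|)
      (fun _ _ => by positivity) (Finset.mem_univ i)
    have h7 := abs_nonneg (ys i)
    rw [hLx]
    refine (abs_add_le _ _).trans ?_
    simp only [Pi.smul_apply, Pi.sub_apply, smul_eq_mul] at h4 h6 ⊢
    linarith
  obtain ⟨Q, hQ, hSQ⟩ := hcpt ρ
  have hxQ : ∀ k, x (k + 1) ∈ Q := fun k => hSQ _ (hx k) (hρ k)
  -- a limit point is a saddle point
  let U : Ultrafilter ℕ := Filter.hyperfilter ℕ
  have hU : (U : Filter ℕ) ≤ atTop := by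
    rw [← Nat.cofinite_eq_atTop]; exact Filter.hyperfilter_le_cofinite
  -- One ultrafilter makes `x`, `y` and `z` converge together, in place of repeated extraction of
  -- subsequences.
  obtain ⟨X, -, hX⟩ := hQ.ultrafilter_le_nhds (U.map fun k => x (k + 1))
    (le_principal_iff.2 (Filter.mem_map.2 (Filter.univ_mem' hxQ)))
  obtain ⟨yl, -, hyl⟩ := (isCompact_univ_pi fun _ => isCompact_Icc).ultrafilter_le_nhds (U.map y)
    (le_principal_iff.2 (Filter.mem_map.2 (Filter.univ_mem' hyb)))
  obtain ⟨zl, -, hzl⟩ := (isCompact_univ_pi fun _ => isCompact_Icc).ultrafilter_le_nhds (U.map z)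
    (le_principal_iff.2 (Filter.mem_map.2 (Filter.univ_mem' hzb)))
  replace hX : Tendsto (fun k => x (k + 1)) U (𝓝 X) := hX
  replace hyl : Tendsto y U (𝓝 yl) := hyl
  replace hzl : Tendsto z U (𝓝 zl) := hzl
  have hXS : X ∈ S := hS.mem_of_tendsto hX (Eventually.of_forall hx)
  have hdu : Tendsto (fun k => L (x (k + 1)) - z k) atTop (𝓝 0) := by
    have := hdz.add (hdy.const_smul κ⁻¹)
    simp only [smul_zero, add_zero] at this
    refine this.congr fun k => ?_
    rw [hLx]; abel
  have hLX : L X = zl := by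
    refine tendsto_nhds_unique ((hL.tendsto X).comp hX) ?_
    have := hzl.add (hdu.mono_left hU)
    simp only [add_zero] at this
    refine this.congr fun k => ?_
    simp
  have hylσ : ∀ i, yl (σ i) = -yl i := fun i =>
    tendsto_nhds_unique ((tendsto_pi_nhds.1 hyl) (σ i))
      (((tendsto_pi_nhds.1 hyl) i).neg.congr fun k => (hyσ k i).symm)
  have hzlσ : ∀ i, zl (σ i) = zl i := fun i =>
    tendsto_nhds_unique ((tendsto_pi_nhds.1 hzl) (σ i))
      (((tendsto_pi_nhds.1 hzl) i).congr fun k => (hzσ k i).symm)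
  -- An antisymmetric family is orthogonal to a symmetric one, so the multiplier term vanishes at
  -- consensus points.
  have hsum0 : ∑ i, yl i * zl i = 0 := by
    have h1 : ∑ i, yl (σ i) * zl (σ i) = ∑ i, yl i * zl i :=
      Equiv.sum_comp (hσ.toPerm σ) fun i => yl i * zl i
    simp only [hylσ, hzlσ, neg_mul, Finset.sum_neg_distrib] at h1
    linarith
  have hsad : ∀ v ∈ S, f X ≤ f v + ∑ i, yl i * L v i := by
    intro v hv
    have hfX : Tendsto (fun k => f (x (k + 1))) U (𝓝 (f X)) :=
      (hfc X hXS).tendsto.comp (tendsto_nhdsWithin_iff.2 ⟨hX, Eventually.of_forall hx⟩)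
    have hs : Tendsto (fun k => ∑ i, (y k i + κ * (L (x (k + 1)) i - z k i)) *
        (L (x (k + 1)) i - L v i)) U (𝓝 (∑ i, (yl i + κ * 0) * (zl i - L v i))) := by
      refine tendsto_finsetSum _ fun i _ => Tendsto.mul ?_ ?_
      · exact ((tendsto_pi_nhds.1 hyl) i).add
          (((tendsto_pi_nhds.1 (hdu.mono_left hU)) i).const_mul κ)
      · rw [← hLX]
        exact ((tendsto_pi_nhds.1 ((hL.tendsto X).comp hX)) i).sub_const _
    have := le_of_tendsto (hfX.add hs) (Eventually.of_forall fun k => hVI k v hv)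
    simp only [mul_zero, add_zero, mul_sub, Finset.sum_sub_distrib, hsum0] at this
    linarith
  -- convergence of the whole sequence
  obtain ⟨l, hl⟩ := hlim X yl hXS (fun i => by rw [hLX, hzlσ]) hylσ hsad
  have hl0 : Tendsto (fun k => lyapunov κ (y k) (z k) yl (L X)) U (𝓝 0) := by
    have hc : Continuous fun w : (ι → ℝ) × (ι → ℝ) => lyapunov κ w.1 w.2 yl (L X) := by
      unfold lyapunov; fun_prop
    have := (hc.tendsto (yl, zl)).comp (hyl.prodMk_nhds hzl)
    simpa [lyapunov, hLX, Function.comp_def] using this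
  -- The distance to this saddle point is monotone, hence convergent; its limit along `U` is zero,
  -- so its limit along the whole sequence is zero.
  rw [tendsto_nhds_unique (hl.mono_left hU) hl0] at hl
  obtain ⟨h1, h2⟩ := hsmall y z (fun _ => yl) (fun _ => L X) atTop hl
  have hyt : Tendsto y atTop (𝓝 yl) := tendsto_sub_nhds_zero_iff.1 h1
  have hzt : Tendsto z atTop (𝓝 zl) := hLX ▸ tendsto_sub_nhds_zero_iff.1 h2
  have hLt : Tendsto (fun k => L (x (k + 1))) atTop (𝓝 zl) := by
    have := hzt.add hdu
    simp only [add_zero] at this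
    exact this.congr fun k => by simp
  have hLt' := (tendsto_add_atTop_iff_nat (f := fun k => L (x k)) 1).1 hLt
  refine ⟨yl, zl, hyt, hLt', hzlσ, fun V hV Y hY => ?_⟩
  have hev : ∀ᶠ k in (V : Filter ℕ), x k ∈ S := hV (by
    filter_upwards [eventually_ge_atTop 1] with k hk
    obtain ⟨m, rfl⟩ := Nat.exists_eq_add_of_le' hk
    exact hx m)
  have hYS : Y ∈ S := hS.mem_of_tendsto hY hev
  refine ⟨hYS, tendsto_nhds_unique ((hL.tendsto Y).comp hY) (hLt'.mono_left hV), ?_⟩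
  have hfY : Tendsto (fun k => f (x k)) V (𝓝 (f Y)) :=
    (hfc Y hYS).tendsto.comp (tendsto_nhdsWithin_iff.2 ⟨hY, hev⟩)
  have hs : Tendsto (fun k => ∑ i, (y k i + κ * (L (x (k + 1)) i - z k i)) *
      (L (x (k + 1)) i - L X i)) atTop (𝓝 (∑ i, (yl i + κ * 0) * (zl i - L X i))) := by
    refine tendsto_finsetSum _ fun i _ => Tendsto.mul ?_ ?_
    · exact ((tendsto_pi_nhds.1 hyt) i).add (((tendsto_pi_nhds.1 hdu) i).const_mul κ)
    · exact ((tendsto_pi_nhds.1 hLt) i).sub_const _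
  simp only [hLX, sub_self, mul_zero, Finset.sum_const_zero] at hs
  -- The variational inequality tested at the saddle point `X`: its linear term tends to zero
  -- because the readings converge to `L X`. The value at `x k` goes with the multiplier of round `k
  -- - 1`, hence the shift.
  have hle : f Y ≤ f X := by
    have hs' := (tendsto_const_nhds (x := f X)).sub (hs.comp (tendsto_sub_atTop_nat 1))
    rw [sub_zero] at hs'
    refine le_of_tendsto_of_tendsto hfY (hs'.mono_left hV) (hV ?_)
    filter_upwards [eventually_ge_atTop 1] with k hk
    obtain ⟨m, rfl⟩ := Nat.exists_eq_add_of_le' hk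
    have := hVI m X hXS
    simp only [Function.comp, Nat.add_sub_cancel]
    rw [hLX] at this
    linarith
  intro v hv hvσ
  have h3 := hsad v hv
  have h4 : ∑ i, yl i * L v i = 0 := by
    have h1 : ∑ i, yl (σ i) * L v (σ i) = ∑ i, yl i * L v i :=
      Equiv.sum_comp (hσ.toPerm σ) fun i => yl i * L v i
    simp only [hylσ, hvσ, neg_mul, Finset.sum_neg_distrib] at h1
    linarith
  linarith

end Consensus

/-! ### Positive semidefinite matrices -/

/-- A positive semidefinite matrix is a Gram matrix. -/
theorem exists_gram {ι : Type*} [Fintype ι] {X : Matrix ι ι ℂ} (hX : X.PosSemidef) :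
    ∃ v : ι → EuclideanSpace ℂ ι, ∀ m n, inner ℂ (v m) (v n) = X m n := by
  classical
  open scoped MatrixOrder in
  obtain ⟨B, hB⟩ := CStarAlgebra.nonneg_iff_eq_star_mul_self.mp hX.nonneg
  refine ⟨fun m => WithLp.toLp 2 fun k => B k m, fun m n => ?_⟩
  rw [hB, star_eq_conjTranspose, Matrix.mul_apply, PiLp.inner_apply]
  refine Finset.sum_congr rfl fun k _ => ?_
  simp [mul_comm]

/-- The entries of a positive semidefinite matrix are bounded by its diagonal. -/
theorem norm_apply_le_of_posSemidef {ι : Type*} [Fintype ι] {X : Matrix ι ι ℂ}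
    (hX : X.PosSemidef) {r : ℝ} (hr : ∀ m, (X m m).re ≤ r) (m n : ι) : ‖X m n‖ ≤ r := by
  obtain ⟨v, hv⟩ := exists_gram hX
  have hn : ∀ k, ‖v k‖ ≤ √r := fun k => by
    refine Real.le_sqrt_of_sq_le ?_
    have : ‖v k‖ ^ 2 = (inner ℂ (v k) (v k)).re := by
      rw [inner_self_eq_norm_sq_to_K]; norm_cast
    rw [this, hv]
    exact hr k
  have hr0 : 0 ≤ r := by
    have h := hX.diag_nonneg (i := m)
    exact (Complex.le_def.1 h).1.trans (hr m)
  rw [← hv]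
  calc ‖inner ℂ (v m) (v n)‖ ≤ ‖v m‖ * ‖v n‖ := norm_inner_le_norm _ _
    _ ≤ √r * √r := mul_le_mul (hn m) (hn n) (norm_nonneg _) (Real.sqrt_nonneg _)
    _ = r := Real.mul_self_sqrt hr0

theorem isClosed_posSemidef {ι : Type*} [Fintype ι] :
    IsClosed {X : Matrix ι ι ℂ | X.PosSemidef} := by
  simp only [posSemidef_iff_dotProduct_mulVec, Matrix.IsHermitian, Set.ofPred_and,
    Set.ofPred_forall]
  refine (isClosed_eq continuous_id.matrix_conjTranspose continuous_id).inter
    (isClosed_iInter fun v => ?_)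
  exact isClosed_le continuous_const
    (continuous_const.dotProduct (continuous_id.matrix_mulVec continuous_const))

theorem convex_posSemidef {ι : Type*} : Convex ℝ {X : Matrix ι ι ℂ | X.PosSemidef} := by
  intro X hX Y hY a b ha hb _
  have := (PosSemidef.smul hX (Complex.zero_le_real.2 ha)).add
    (PosSemidef.smul hY (Complex.zero_le_real.2 hb))
  simpa using this

/-- Hermitian part of a matrix. -/
def hermPart {ι : Type*} : Matrix ι ι ℂ →ₗ[ℝ] Matrix ι ι ℂ where
  toFun X := (1 / 2 : ℝ) • (X + Xᴴ)
  map_add' X Y := by simp only [conjTranspose_add, smul_add]; abel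
  map_smul' c X := by
    simp only [conjTranspose_smul, RingHom.id_apply, smul_add, star_trivial]
    simp only [smul_comm c]

theorem hermPart_isHermitian {ι : Type*} (X : Matrix ι ι ℂ) : (hermPart X).IsHermitian := by
  change ((1 / 2 : ℝ) • (X + Xᴴ))ᴴ = (1 / 2 : ℝ) • (X + Xᴴ)
  rw [conjTranspose_smul, conjTranspose_add, conjTranspose_conjTranspose, star_trivial, add_comm]

theorem hermPart_of_isHermitian {ι : Type*} {X : Matrix ι ι ℂ} (hX : X.IsHermitian) :
    hermPart X = X := by
  change (1 / 2 : ℝ) • (X + Xᴴ) = X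
  rw [hX.eq, ← two_smul ℝ X, smul_smul]
  norm_num

theorem continuous_hermPart {ι : Type*} :
    Continuous (hermPart : Matrix ι ι ℂ → Matrix ι ι ℂ) := by
  change Continuous fun X : Matrix ι ι ℂ => (1 / 2 : ℝ) • (X + Xᴴ)
  fun_prop

/-- Near a positive definite matrix, Hermitian parts are positive semidefinite. -/
theorem eventually_hermPart_posSemidef {ι : Type*} [Fintype ι] {V : Matrix ι ι ℂ}
    (hV : V.PosDef) : ∀ᶠ X in 𝓝 V, (hermPart X).PosSemidef := by
  have hq : Continuous fun z : Matrix ι ι ℂ × (ι → ℂ) =>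
      (star z.2 ⬝ᵥ (hermPart z.1 *ᵥ z.2)).re :=
    Complex.continuous_re.comp ((continuous_star.comp continuous_snd).dotProduct
      ((continuous_hermPart.comp continuous_fst).matrix_mulVec continuous_snd))
  have hsph : IsCompact (Metric.sphere (0 : ι → ℂ) 1) := isCompact_sphere _ _
  -- Positivity on the compact unit sphere persists for nearby matrices, uniformly in the vector;
  -- homogeneity extends it to all vectors.
  have hev := hsph.eventually_forall_of_forall_eventually (x₀ := V)
    (P := fun X v => 0 < (star v ⬝ᵥ (hermPart X *ᵥ v)).re) (fun v hv => by
      have hv0 : v ≠ 0 := by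
        rintro rfl; simp at hv
      have := hV.dotProduct_mulVec_pos hv0
      have hpos : 0 < (star v ⬝ᵥ (hermPart V *ᵥ v)).re := by
        rw [hermPart_of_isHermitian hV.isHermitian]
        exact (Complex.lt_def.1 this).1
      exact (hq.tendsto (V, v)).eventually (lt_mem_nhds hpos))
  filter_upwards [hev] with X hX
  refine PosSemidef.of_dotProduct_mulVec_nonneg (hermPart_isHermitian X) fun v => ?_
  have hre : 0 ≤ (star v ⬝ᵥ (hermPart X *ᵥ v)).re := by
    rcases eq_or_ne v 0 with rfl | hv
    · simp
    have hn : 0 < ‖v‖ := norm_pos_iff.2 hv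
    have h1 := hX ((‖v‖⁻¹ : ℂ) • v) (by
      rw [mem_sphere_zero_iff_norm, norm_smul, norm_inv, Complex.norm_real, norm_norm,
        inv_mul_cancel₀ hn.ne'])
    have e : star ((‖v‖⁻¹ : ℂ) • v) ⬝ᵥ (hermPart X *ᵥ ((‖v‖⁻¹ : ℂ) • v))
        = ((‖v‖⁻¹ * ‖v‖⁻¹ : ℝ) : ℂ) * (star v ⬝ᵥ (hermPart X *ᵥ v)) := by
      rw [star_smul, mulVec_smul, smul_dotProduct, dotProduct_smul, smul_smul]
      simp
    rw [e, Complex.re_ofReal_mul] at h1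
    exact (pos_of_mul_pos_right h1 (by positivity)).le
  have him : (star v ⬝ᵥ (hermPart X *ᵥ v)).im = 0 := by
    have := (hermPart_isHermitian X).im_star_dotProduct_mulVec_self v
    simpa using this
  exact Complex.le_def.2 ⟨hre, him.symm⟩

/-! ### Gluing Gram vectors along a tree -/

/-- Families of vectors with the same Gram matrix are related by an isometry. -/
theorem exists_isometry_of_gram_eq {H ι : Type*} [NormedAddCommGroup H] [InnerProductSpace ℂ H]
    [FiniteDimensional ℂ H] [Fintype ι] {v w : ι → H}
    (h : ∀ m n, inner ℂ (v m) (v n) = inner ℂ (w m) (w n)) :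
    ∃ U : H →ₗᵢ[ℂ] H, ∀ n, U (v n) = w n := by
  classical
  let T₁ : (ι → ℂ) →ₗ[ℂ] H := Fintype.linearCombination ℂ v
  let T₂ : (ι → ℂ) →ₗ[ℂ] H := Fintype.linearCombination ℂ w
  have hnorm : ∀ c, ‖T₁ c‖ = ‖T₂ c‖ := by
    intro c
    have : inner ℂ (T₁ c) (T₁ c) = inner ℂ (T₂ c) (T₂ c) := by
      simp only [T₁, T₂, Fintype.linearCombination_apply, sum_inner, inner_sum, inner_smul_left,
        inner_smul_right, h]
    rw [@norm_eq_sqrt_re_inner ℂ, @norm_eq_sqrt_re_inner ℂ _ _ _ _ (T₂ c), this]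
  -- Equal norms give `T₁` and `T₂` the same kernel, so `T₂ ∘ g` does not depend on the chosen
  -- section `g` of `T₁`.
  obtain ⟨g, hg⟩ := T₁.rangeRestrict.exists_rightInverse_of_surjective T₁.range_rangeRestrict
  have hg' : ∀ s : LinearMap.range T₁, T₁ (g s) = s := fun s =>
    congrArg Subtype.val (LinearMap.congr_fun hg s)
  let U₀ : LinearMap.range T₁ →ₗᵢ[ℂ] H :=
    { toLinearMap := T₂ ∘ₗ g
      norm_map' := fun s => by
        simp only [LinearMap.comp_apply]
        rw [← hnorm, hg']
        rfl }
  refine ⟨U₀.extend, fun n => ?_⟩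
  have hT₁ : T₁ (Pi.single n 1) = v n := by simp [T₁]
  have hT₂ : T₂ (Pi.single n 1) = w n := by simp [T₂]
  let s : LinearMap.range T₁ := ⟨v n, ⟨_, hT₁⟩⟩
  have h0 : T₂ (g s - Pi.single n 1) = 0 := by
    rw [← norm_eq_zero, ← hnorm, map_sub, hg', hT₁, sub_self, norm_zero]
  rw [map_sub, hT₂, sub_eq_zero] at h0
  calc U₀.extend (v n) = U₀.extend s := rfl
    _ = U₀ s := LinearIsometry.extend_apply _ _
    _ = w n := h0

/-- On a tree, local choices that can be matched along edges can be made consistently. -/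
theorem exists_section_of_isTree {V : Type*} {G : SimpleGraph V} (hG : G.IsTree) {X : V → Type*}
    (hX : ∀ a, Nonempty (X a)) (Rel : ∀ a b, X a → X b → Prop)
    (hsymm : ∀ a b x y, Rel a b x y → Rel b a y x)
    (hext : ∀ a b, G.Adj a b → ∀ y, ∃ x, Rel a b x y) :
    ∃ s : ∀ a, X a, ∀ a b, G.Adj a b → Rel a b (s a) (s b) := by
  classical
  choose e he using hext
  obtain ⟨r⟩ := hG.connected.nonempty
  -- Choose freely at the root `r` and propagate outwards along the unique path from `r` to each
  -- vertex.
  let build : ∀ a b, G.Walk a b → X b → X a := fun a b p =>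
    SimpleGraph.Walk.rec (motive := fun a b _ => X b → X a) (fun x => x)
      (fun hadj _ ih x => e _ _ hadj (ih x)) p
  have hbuild : ∀ a b c (hadj : G.Adj a b) (p : G.Walk b c) x,
      build a c (.cons hadj p) x = e a b hadj (build b c p x) := fun _ _ _ _ _ _ => rfl
  choose path hpath huniq using fun a => hG.existsUnique_path a r
  have hcons : ∀ a b, ∀ hadj : G.Adj a b, a ∉ (path b).support →
      path a = .cons hadj (path b) := fun a b hadj h =>
    (huniq a _ ((hpath b).cons h)).symm
  refine ⟨fun a => build a r (path a) (hX r).some, fun a b hadj => ?_⟩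
  -- For adjacent vertices, one of the two paths to the root extends the other by this edge.
  by_cases h : a ∈ (path b).support
  · have hb : b ∉ (path a).support := by
      have := hG.isAcyclic.ne_mem_support_of_support_of_adj_of_isPath (hpath b).reverse
        (hpath a).reverse hadj.symm (by simpa using h)
      simpa using this
    beta_reduce
    rw [hcons b a hadj.symm hb, hbuild]
    exact hsymm _ _ _ _ (he _ _ _ _)
  · beta_reduce
    rw [hcons a b hadj h, hbuild]
    exact he _ _ _ _

/-! ### Completion of consistent cluster voltages -/

namespace Clustering

variable {N Na : ℕ} {F : Feeder N} (K : Clustering F Na)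

theorem mem_ext_cluster (n : Fin (N + 1)) : n ∈ K.ext (K.cluster n) := by
  classical
  simp [ext]

theorem mem_nbr {a j : Fin Na} : j ∈ K.nbr a ↔ K.graph.Adj a j := by
  classical
  simp [nbr]

theorem mem_nbr_symm {a j : Fin Na} (h : j ∈ K.nbr a) : a ∈ K.nbr j :=
  K.mem_nbr.2 (K.mem_nbr.1 h).symm

theorem mem_tie_symm {a j : Fin Na} {n : Fin (N + 1)} (h : n ∈ K.tie a j) : n ∈ K.tie j a := by
  classical
  simp only [tie, Finset.mem_filter, Finset.mem_univ, true_and] at h ⊢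
  obtain ⟨m, hm, h⟩ := h
  exact ⟨m, hm, h.symm⟩

theorem mem_tie_of_mem_ext {a : Fin Na} {n : Fin (N + 1)} (hn : n ∈ K.ext a)
    (hna : K.cluster n ≠ a) : n ∈ K.tie a (K.cluster n) ∧ K.cluster n ∈ K.nbr a := by
  classical
  have hn' := hn
  simp only [ext, Finset.mem_filter, Finset.mem_univ, true_and] at hn'
  obtain ⟨-, m, hadj, hm⟩ := hn'.resolve_left hna
  have hadj' : K.graph.Adj a (K.cluster n) :=
    And.intro hna.symm ⟨n, Finset.mem_inter.2 ⟨hn, K.mem_ext_cluster n⟩⟩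
  refine ⟨?_, K.mem_nbr.2 hadj'⟩
  simp only [tie, Finset.mem_filter, Finset.mem_univ, true_and]
  exact ⟨m, hadj.symm, by simp [hm]⟩

/-- Cluster matrices that agree on the connecting lines. -/
def Agree (W : (a : Fin Na) → Matrix (K.ext a) (K.ext a) ℂ) : Prop :=
  ∀ a, ∀ j ∈ K.nbr a, K.own a j (W a) = K.other a j (W j)

theorem Agree.apply_eq {K : Clustering F Na} {W : (a : Fin Na) → Matrix (K.ext a) (K.ext a) ℂ}
    (hW : K.Agree W) {a j : Fin Na} (hj : j ∈ K.nbr a) {m n : Fin (N + 1)}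
    (hm : m ∈ K.tie a j) (hn : n ∈ K.tie a j) :
    W a ⟨m, K.tie_subset_left a j hm⟩ ⟨n, K.tie_subset_left a j hn⟩ =
      W j ⟨m, K.tie_subset_right a j hm⟩ ⟨n, K.tie_subset_right a j hn⟩ :=
  congrFun (congrFun (hW a j hj) ⟨m, hm⟩) ⟨n, hn⟩

/-- When the graph of clusters is a tree, positive semidefinite cluster matrices that agree on the
connecting lines are the sub-matrices of a positive semidefinite matrix. -/
theorem exists_completion (htree : K.graph.IsTree)
    {W : (a : Fin Na) → Matrix (K.ext a) (K.ext a) ℂ} (hpsd : ∀ a, (W a).PosSemidef)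
    (hW : K.Agree W) :
    ∃ V : Matrix (Fin (N + 1)) (Fin (N + 1)) ℂ, V.PosSemidef ∧ ∀ a, K.sub a V = W a := by
  classical
  let H := EuclideanSpace ℂ (Fin (N + 1))
  let X : Fin Na → Type := fun a =>
    {v : Fin (N + 1) → H // ∀ m n : K.ext a, inner ℂ (v m) (v n) = W a m n}
  have hX : ∀ a, Nonempty (X a) := by
    intro a
    -- Padding `W a` by zeros puts the Gram vectors of all clusters into the same space; vectors at
    -- nodes outside `K.ext a` are unconstrained.
    let P : Matrix (K.ext a) (Fin (N + 1)) ℂ := Matrix.of fun k n => if k.1 = n then 1 else 0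
    obtain ⟨v, hv⟩ := exists_gram ((hpsd a).conjTranspose_mul_mul_same P)
    refine ⟨v, fun m n => ?_⟩
    rw [hv]
    simp [P, Matrix.mul_apply, apply_ite]
  obtain ⟨s, hs⟩ := exists_section_of_isTree htree hX
    (fun a b v w => ∀ n ∈ K.tie a b, v.1 n = w.1 n)
    (fun a b v w h n hn => (h n (K.mem_tie_symm hn)).symm)
    (fun a b hab w => by
      obtain ⟨v⟩ := hX a
      -- Agreement on the tie says that the two families have equal Gram matrices there. Applying
      -- `U` moves one onto the other without changing the matrix of cluster `a`.
      obtain ⟨U, hU⟩ := exists_isometry_of_gram_eq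
        (v := fun n : K.tie a b => v.1 n) (w := fun n : K.tie a b => w.1 n) (fun m n => by
          rw [v.2 ⟨m, K.tie_subset_left a b m.2⟩ ⟨n, K.tie_subset_left a b n.2⟩,
            w.2 ⟨m, K.tie_subset_right a b m.2⟩ ⟨n, K.tie_subset_right a b n.2⟩]
          exact hW.apply_eq (K.mem_nbr.2 hab) m.2 n.2)
      exact ⟨⟨fun n => U (v.1 n), fun m n => by rw [U.inner_map_map, v.2]⟩,
        fun n hn => hU ⟨n, hn⟩⟩)
  let v : Fin (N + 1) → H := fun n => (s (K.cluster n)).1 n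
  -- A foreign node of `K.ext a` lies on the tie with its own cluster, so matching on ties suffices.
  have hv : ∀ a, ∀ n ∈ K.ext a, v n = (s a).1 n := by
    intro a n hn
    by_cases h : K.cluster n = a
    · subst h; rfl
    · obtain ⟨h1, h2⟩ := K.mem_tie_of_mem_ext hn h
      exact (hs a _ (K.mem_nbr.1 h2) n h1).symm
  refine ⟨Matrix.gram ℂ v, Matrix.posSemidef_gram ℂ v, fun a => ?_⟩
  ext m n
  simp only [sub, submatrix_apply, Matrix.gram_apply]
  rw [hv a m m.2, hv a n n.2, (s a).2]

end Clustering

/-- The Schur complement form of the constraint `‖v‖² ≤ t`. -/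
theorem schurLMI_iff {ι : Type*} [Fintype ι] [DecidableEq ι] (t : ℝ) (v : ι → ℝ) :
    Costs.SchurLMI t v ↔ ∑ i, v i ^ 2 ≤ t := by
  have e : (Matrix.replicateCol Unit v) = (Matrix.replicateRow Unit v)ᴴ := by
    ext; simp
  have e' : -(Matrix.replicateRow Unit v)ᴴ = (-Matrix.replicateRow Unit v)ᴴ := by
    rw [conjTranspose_neg]
  let _ : Invertible (1 : Matrix ι ι ℝ) := invertibleOne
  rw [Costs.SchurLMI, fromBlocks_neg, neg_neg, e, e',
    PosDef.fromBlocks₂₂ _ _ (PosDef.one : (1 : Matrix ι ι ℝ).PosDef)]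
  have h : (-(Matrix.of fun _ _ => -t) - -Matrix.replicateRow Unit v * (1 : Matrix ι ι ℝ)⁻¹ *
      (-Matrix.replicateRow Unit v)ᴴ : Matrix Unit Unit ℝ) = diagonal fun _ => t - ∑ i, v i ^ 2 := by
    ext i j
    simp [Matrix.mul_apply, diagonal, sq]
  rw [h, posSemidef_diagonal_iff]
  simp

theorem trace_transpose_mul {ι : Type*} [Fintype ι] (A B : Matrix ι ι ℝ) :
    (Aᵀ * B).trace = ∑ mn : ι × ι, A mn.1 mn.2 * B mn.1 mn.2 := by
  simp only [trace, diag_apply, Matrix.mul_apply, transpose_apply, Fintype.sum_prod_type]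
  exact Finset.sum_comm

/-! ### Exchanged quantities, their involution and their multipliers -/

namespace Clustering

variable {N Na : ℕ} {F : Feeder N} (K : Clustering F Na)

theorem sum_houses (g : F.H → ℝ) : ∑ a, ∑ h : K.Houses a, g h.1 = ∑ h, g h :=
  Fintype.sum_fiberwise (fun h : F.H => K.cluster h) g

/-- Joint variables `(V, pbar, qbar, p, q)` of all customers and cluster energy managers. -/
abbrev Joint (K : Clustering F Na) : Type :=
  ((a : Fin Na) → Matrix (K.ext a) (K.ext a) ℂ) × (F.H → ℝ) × (F.H → ℝ) × (F.H → ℝ) × (F.H → ℝ)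

/-- Quantities that are exchanged: for each house the copy (`true`) or the original (`false`) of the
active (`true`) or reactive (`false`) setpoint, and for each ordered pair of neighbouring clusters
the real (`true`) or imaginary (`false`) parts of the tie-line voltages. -/
abbrev Link (K : Clustering F Na) : Type :=
  (F.H × Bool × Bool) ⊕ (Σ a : Fin Na, Σ j : K.nbr a, (K.tie a j × K.tie a j) × Bool)

/-- The counterpart of an exchanged quantity. -/
def swap : K.Link → K.Link
  | .inl (h, c, t) => .inl (h, !c, t)
  | .inr ⟨a, j, (m, n), t⟩ => .inr ⟨j, ⟨a, K.mem_nbr_symm j.2⟩,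
      (⟨m, K.mem_tie_symm m.2⟩, ⟨n, K.mem_tie_symm n.2⟩), t⟩

theorem swap_involutive : Function.Involutive K.swap := by
  rintro (⟨h, c, t⟩ | ⟨a, j, ⟨m, n⟩, t⟩)
  · simp [swap]
  · rfl

/-- Values of the exchanged quantities. -/
def reading : K.Joint →ₗ[ℝ] K.Link → ℝ where
  toFun x
    | .inl (h, true, true) => x.2.1 h
    | .inl (h, true, false) => x.2.2.1 h
    | .inl (h, false, true) => x.2.2.2.1 h
    | .inl (h, false, false) => x.2.2.2.2 h
    | .inr ⟨a, j, (m, n), true⟩ => (K.own a j (x.1 a) m n).re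
    | .inr ⟨a, j, (m, n), false⟩ => (K.own a j (x.1 a) m n).im
  map_add' x y := by
    ext (⟨h, (_ | _), (_ | _)⟩ | ⟨a, j, ⟨m, n⟩, (_ | _)⟩) <;> simp [own]
  map_smul' c x := by
    ext (⟨h, (_ | _), (_ | _)⟩ | ⟨a, j, ⟨m, n⟩, (_ | _)⟩) <;> simp [own]

theorem continuous_reading : Continuous K.reading := by
  refine continuous_pi ?_
  rintro (⟨h, (_ | _), (_ | _)⟩ | ⟨a, j, ⟨m, n⟩, (_ | _)⟩)
  · change Continuous fun x : K.Joint => x.2.2.2.2 h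
    fun_prop
  · change Continuous fun x : K.Joint => x.2.2.2.1 h
    fun_prop
  · change Continuous fun x : K.Joint => x.2.2.1 h
    fun_prop
  · change Continuous fun x : K.Joint => x.2.1 h
    fun_prop
  · change Continuous fun x : K.Joint => (x.1 a ⟨m, _⟩ ⟨n, _⟩).im
    exact Complex.continuous_im.comp
      (((continuous_apply a).comp continuous_fst).matrix_elem _ _)
  · change Continuous fun x : K.Joint => (x.1 a ⟨m, _⟩ ⟨n, _⟩).re
    exact Complex.continuous_re.comp
      (((continuous_apply a).comp continuous_fst).matrix_elem _ _)

end Clustering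

namespace Iterate

variable {N Na : ℕ} {F : Feeder N} {K : Clustering F Na}

/-- The primal variables of an iterate. -/
def joint (s : Iterate K) : K.Joint := (s.V, s.pbar, s.qbar, s.p, s.q)

/-- The multipliers of the exchanged quantities. -/
def multiplier (s : Iterate K) : K.Link → ℝ
  | .inl (h, true, true) => s.γ h
  | .inl (h, true, false) => s.μ h
  -- The opposite sign makes the setpoint multipliers antisymmetric under `swap`.
  | .inl (h, false, true) => -s.γ h
  | .inl (h, false, false) => -s.μ h
  | .inr ⟨a, j, (m, n), true⟩ => s.Υ a j m n
  | .inr ⟨a, j, (m, n), false⟩ => s.Ψ a j m n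

end Iterate

namespace Costs

variable {N Na : ℕ} {F : Feeder N} {K : Clustering F Na} (D : Costs K)

/-- Total cost of the customers and of the cluster energy managers. -/
def jointCost (x : K.Joint) : ℝ :=
  ∑ a, D.Cbar a (hermPart (x.1 a)) (fun h => x.2.1 h.1) (fun h => x.2.2.1 h.1) +
    ∑ h, D.R h (x.2.2.2.1 h)

/-- Constraints of the customers and of the cluster energy managers, without the consensus
constraints. -/
def jointFeasible : Set K.Joint := {x |
  (∀ a, (x.1 a, (fun h : K.Houses a => x.2.1 h.1), (fun h : K.Houses a => x.2.2.1 h.1)) ∈ D.flows a ∧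
    (x.1 a).PosSemidef) ∧ ∀ h, (x.2.2.2.1 h, x.2.2.2.2 h) ∈ F.region h}

/-! ### The algorithm as an alternating direction method -/

/-- Squared norm of the real parts of the deviation from the mean tie-line voltages. -/
def devRe (s : Iterate K) (a : Fin Na) (X : Matrix (K.ext a) (K.ext a) ℂ) (j : K.nbr a) : ℝ :=
  ∑ mn : K.tie a j × K.tie a j, (D.deviation s a j X mn.1 mn.2).re ^ 2

/-- Squared norm of the imaginary parts of the deviation from the mean tie-line voltages. -/
def devIm (s : Iterate K) (a : Fin Na) (X : Matrix (K.ext a) (K.ext a) ℂ) (j : K.nbr a) : ℝ :=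
  ∑ mn : K.tie a j × K.tie a j, (D.deviation s a j X mn.1 mn.2).im ^ 2

/-- Augmented Lagrangian of the joint problem at the iterate `s`. -/
def augmented (κ : ℝ) (s : Iterate K) (v : K.Joint) : ℝ :=
  D.jointCost v + ∑ i, s.multiplier i * K.reading v i +
    κ / 2 * ∑ i, (K.reading v i - (K.reading s.joint i + K.reading s.joint (K.swap i)) / 2) ^ 2

/-- The quadratic terms couple the agents only through the previous iterate, so the augmented
Lagrangian splits into the local objectives. Completing the squares for the setpoints leaves a
constant that depends on `s` alone; the slacks α and β sit at their least admissible values. -/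
theorem augmented_eq (κ : ℝ) (s : Iterate K) {v : K.Joint} (hv : ∀ a, (v.1 a).IsHermitian) :
    D.augmented κ s v = ∑ h, D.customerCost κ s h (v.2.2.2.1 h, v.2.2.2.2 h) +
      ∑ a, D.managerCost κ s a (v.1 a, (fun h => v.2.1 h.1), (fun h => v.2.2.1 h.1),
        D.devRe s a (v.1 a), D.devIm s a (v.1 a)) +
      ∑ h, κ * (((s.pbar h + s.p h) / 2) ^ 2 + ((s.qbar h + s.q h) / 2) ^ 2) := by
  have hherm : ∀ a, hermPart (v.1 a) = v.1 a := fun a => hermPart_of_isHermitian (hv a)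
  have htie : ∀ a, ∀ j : K.nbr a,
      κ / 2 * (D.devRe s a (v.1 a) j + D.devIm s a (v.1 a) j)
        + ((s.Υ a j)ᵀ * (K.own a j (v.1 a)).map Complex.re).trace
        + ((s.Ψ a j)ᵀ * (K.own a j (v.1 a)).map Complex.im).trace =
      ∑ e : (K.tie a j × K.tie a j) × Bool,
        (s.multiplier (.inr ⟨a, j, e⟩) * K.reading v (.inr ⟨a, j, e⟩) +
        κ / 2 * (K.reading v (.inr ⟨a, j, e⟩) - (K.reading s.joint (.inr ⟨a, j, e⟩) +
          K.reading s.joint (K.swap (.inr ⟨a, j, e⟩))) / 2) ^ 2) := by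
    intro a j
    rw [Fintype.sum_prod_type, trace_transpose_mul, trace_transpose_mul, devRe, devIm,
      ← Finset.sum_add_distrib, Finset.mul_sum, ← Finset.sum_add_distrib,
      ← Finset.sum_add_distrib]
    refine Finset.sum_congr rfl fun mn _ => ?_
    obtain ⟨m, n⟩ := mn
    rw [Fintype.sum_bool]
    have hre : (D.deviation s a j (v.1 a) m n).re = K.reading v (.inr ⟨a, j, (m, n), true⟩) -
        (K.reading s.joint (.inr ⟨a, j, (m, n), true⟩) +
          K.reading s.joint (K.swap (.inr ⟨a, j, (m, n), true⟩))) / 2 := by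
      -- The reading at the swapped link is an entry of `own j a`, which unfolds to the same entry
      -- of `other a j`.
      change (K.own a j (v.1 a) m n
        - (1 / 2 : ℂ) * (K.own a j (s.V a) m n + K.other a j (s.V j) m n)).re =
        (K.own a j (v.1 a) m n).re
          - ((K.own a j (s.V a) m n).re + (K.other a j (s.V j) m n).re) / 2
      simp only [Complex.sub_re, Complex.mul_re, Complex.add_re, Complex.add_im]
      norm_num
      ring
    have him : (D.deviation s a j (v.1 a) m n).im = K.reading v (.inr ⟨a, j, (m, n), false⟩) -
        (K.reading s.joint (.inr ⟨a, j, (m, n), false⟩) +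
          K.reading s.joint (K.swap (.inr ⟨a, j, (m, n), false⟩))) / 2 := by
      change (K.own a j (v.1 a) m n
        - (1 / 2 : ℂ) * (K.own a j (s.V a) m n + K.other a j (s.V j) m n)).im =
        (K.own a j (v.1 a) m n).im
          - ((K.own a j (s.V a) m n).im + (K.other a j (s.V j) m n).im) / 2
      simp only [Complex.sub_im, Complex.mul_im, Complex.add_re, Complex.add_im]
      norm_num
      ring
    rw [hre, him]
    change _ + s.Υ a j m n * K.reading v (.inr ⟨a, j, (m, n), true⟩)
      + s.Ψ a j m n * K.reading v (.inr ⟨a, j, (m, n), false⟩) =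
      (s.Υ a j m n * _ + _) + (s.Ψ a j m n * _ + _)
    ring
  have hhouse : ∀ h : F.H, ∑ c : Bool × Bool,
      (s.multiplier (.inl (h, c)) * K.reading v (.inl (h, c)) +
        κ / 2 * (K.reading v (.inl (h, c)) - (K.reading s.joint (.inl (h, c)) +
          K.reading s.joint (K.swap (.inl (h, c)))) / 2) ^ 2) + D.R h (v.2.2.2.1 h) =
      D.customerCost κ s h (v.2.2.2.1 h, v.2.2.2.2 h) +
      (κ / 2 * (v.2.1 h ^ 2 + v.2.2.1 h ^ 2)
      + v.2.1 h * (s.γ h - κ / 2 * s.pbar h - κ / 2 * s.p h)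
      + v.2.2.1 h * (s.μ h - κ / 2 * s.qbar h - κ / 2 * s.q h)) +
      κ * (((s.pbar h + s.p h) / 2) ^ 2 + ((s.qbar h + s.q h) / 2) ^ 2) := by
    intro h
    rw [Fintype.sum_prod_type, Fintype.sum_bool, Fintype.sum_bool, Fintype.sum_bool]
    change (s.γ h * v.2.1 h + κ / 2 * (v.2.1 h - (s.pbar h + s.p h) / 2) ^ 2
      + (s.μ h * v.2.2.1 h + κ / 2 * (v.2.2.1 h - (s.qbar h + s.q h) / 2) ^ 2))
      + (-s.γ h * v.2.2.2.1 h + κ / 2 * (v.2.2.2.1 h - (s.p h + s.pbar h) / 2) ^ 2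
      + (-s.μ h * v.2.2.2.2 h + κ / 2 * (v.2.2.2.2 h - (s.q h + s.qbar h) / 2) ^ 2))
      + D.R h (v.2.2.2.1 h) = _
    simp only [customerCost]
    ring
  have hman : ∀ a, D.managerCost κ s a (v.1 a, (fun h => v.2.1 h.1), (fun h => v.2.2.1 h.1),
      D.devRe s a (v.1 a), D.devIm s a (v.1 a)) =
      D.Cbar a (v.1 a) (fun h => v.2.1 h.1) (fun h => v.2.2.1 h.1) +
      ∑ h : K.Houses a, (κ / 2 * (v.2.1 h.1 ^ 2 + v.2.2.1 h.1 ^ 2)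
        + v.2.1 h.1 * (s.γ h.1 - κ / 2 * s.pbar h.1 - κ / 2 * s.p h.1)
        + v.2.2.1 h.1 * (s.μ h.1 - κ / 2 * s.qbar h.1 - κ / 2 * s.q h.1)) +
      ∑ j : K.nbr a, ∑ e : (K.tie a j × K.tie a j) × Bool,
        (s.multiplier (.inr ⟨a, j, e⟩) * K.reading v (.inr ⟨a, j, e⟩) +
        κ / 2 * (K.reading v (.inr ⟨a, j, e⟩) - (K.reading s.joint (.inr ⟨a, j, e⟩) +
          K.reading s.joint (K.swap (.inr ⟨a, j, e⟩))) / 2) ^ 2) := by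
    intro a
    simp only [← htie]
    rfl
  simp only [hman, Finset.sum_add_distrib (s := (Finset.univ : Finset (Fin Na)))]
  rw [K.sum_houses fun h => κ / 2 * (v.2.1 h ^ 2 + v.2.2.1 h ^ 2)
      + v.2.1 h * (s.γ h - κ / 2 * s.pbar h - κ / 2 * s.p h)
      + v.2.2.1 h * (s.μ h - κ / 2 * s.qbar h - κ / 2 * s.q h)]
  have hcomb : ∑ i, s.multiplier i * K.reading v i + κ / 2 * ∑ i, (K.reading v i -
      (K.reading s.joint i + K.reading s.joint (K.swap i)) / 2) ^ 2 =
      ∑ i, (s.multiplier i * K.reading v i + κ / 2 * (K.reading v i -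
      (K.reading s.joint i + K.reading s.joint (K.swap i)) / 2) ^ 2) := by
    rw [Finset.mul_sum, ← Finset.sum_add_distrib]
  have hH := Finset.sum_congr (s₁ := (Finset.univ : Finset F.H)) rfl fun h _ => hhouse h
  simp only [Finset.sum_add_distrib (s := (Finset.univ : Finset F.H))] at hH ⊢
  rw [augmented, add_assoc, hcomb, Fintype.sum_sum_type, Fintype.sum_prod_type, Fintype.sum_sigma]
  simp only [Fintype.sum_sigma, jointCost, hherm]
  linarith

variable {D} {κ : ℝ}

/-- The primal update minimizes the augmented Lagrangian. -/
theorem Step.augmented_le (hκ : 0 < κ) {s s' : Iterate K} (h : D.Step κ s s') :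
    s'.joint ∈ D.jointFeasible ∧
      ∀ v ∈ D.jointFeasible, D.augmented κ s s'.joint ≤ D.augmented κ s v := by
  choose α β hαβ using h.manager
  have hmem : s'.joint ∈ D.jointFeasible :=
    ⟨fun a => ⟨(hαβ a).1.1, (hαβ a).1.2.1⟩, fun k => (h.customer k).1⟩
  refine ⟨hmem, fun v hv => ?_⟩
  rw [D.augmented_eq κ s fun a => (hmem.1 a).2.isHermitian,
    D.augmented_eq κ s fun a => (hv.1 a).2.isHermitian]
  gcongr with k _ a _
  · exact (h.customer k).2 (hv.2 k)
  · refine le_trans ?_ (isMinOn_iff.1 (hαβ a).2 (v.1 a, (fun h => v.2.1 h.1), (fun h => v.2.2.1 h.1),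
        D.devRe s a (v.1 a), D.devIm s a (v.1 a)) ⟨(hv.1 a).1, (hv.1 a).2, fun j =>
        ⟨Finset.sum_nonneg fun _ _ => sq_nonneg _, Finset.sum_nonneg fun _ _ => sq_nonneg _,
          (schurLMI_iff _ _).2 le_rfl, (schurLMI_iff _ _).2 le_rfl⟩⟩)
    have hS := (hαβ a).1.2.2
    simp only [managerCost, Iterate.joint]
    gcongr with j _
    · exact (schurLMI_iff _ _).1 (hS j).2.2.1
    · exact (schurLMI_iff _ _).1 (hS j).2.2.2

theorem Step.multiplier_eq {s s' : Iterate K} (h : D.Step κ s s') (i : K.Link) :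
    s'.multiplier i = s.multiplier i +
      κ / 2 * (K.reading s'.joint i - K.reading s'.joint (K.swap i)) := by
  rcases i with ⟨k, (_ | _), (_ | _)⟩ | ⟨a, j, ⟨m, n⟩, (_ | _)⟩
  · change -s'.μ k = -s.μ k + κ / 2 * (s'.q k - s'.qbar k)
    rw [h.dual_q]; ring
  · change -s'.γ k = -s.γ k + κ / 2 * (s'.p k - s'.pbar k)
    rw [h.dual_p]; ring
  · exact h.dual_q k
  · exact h.dual_p k
  · exact congrFun (congrFun (h.dual_im a j j.2) m) n
  · exact congrFun (congrFun (h.dual_re a j j.2) m) n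

theorem IsRun.multiplier_zero {x : ℕ → Iterate K} (hx : D.IsRun κ x) : (x 0).multiplier = 0 := by
  ext (⟨k, (_ | _), (_ | _)⟩ | ⟨a, j, ⟨m, n⟩, (_ | _)⟩)
  · simp [Iterate.multiplier, hx.init_q]
  · simp [Iterate.multiplier, hx.init_p]
  · simp [Iterate.multiplier, hx.init_q]
  · simp [Iterate.multiplier, hx.init_p]
  · simp [Iterate.multiplier, hx.init_im a j j.2]
  · simp [Iterate.multiplier, hx.init_re a j j.2]

end Costs

theorem IsPolyhedral.isClosed {E : Type*} [AddCommGroup E] [Module ℝ E] [TopologicalSpace E]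
    [IsTopologicalAddGroup E] [ContinuousSMul ℝ E] [T2Space E] [FiniteDimensional ℝ E] {P : Set E}
    (hP : IsPolyhedral P) : IsClosed P := by
  obtain ⟨s, hs⟩ := hP
  have : P = ⋂ c ∈ s, {x | c.1 x ≤ c.2} := by
    ext x
    simp [hs]
  rw [this]
  exact isClosed_biInter fun c _ =>
    isClosed_le c.1.continuous_of_finiteDimensional continuous_const

theorem IsPolyhedral.congr {E : Type*} [AddCommGroup E] [Module ℝ E] {P Q : E → Prop}
    (hP : IsPolyhedral {x | P x}) (h : ∀ x, Q x ↔ P x) : IsPolyhedral {x | Q x} := by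
  simpa only [h] using hP

/-- The Euclidean norm of the plane is convex. -/
theorem convexOn_sqrt_add_sq {E : Type*} [AddCommGroup E] [Module ℝ E] (u v : E →ₗ[ℝ] ℝ) :
    ConvexOn ℝ Set.univ fun x => √(u x ^ 2 + v x ^ 2) := by
  have h := (convexOn_norm (convex_univ (𝕜 := ℝ) (E := ℂ))).comp_linearMap
    (Complex.equivRealProdLm.symm.toLinearMap ∘ₗ u.prod v)
  refine h.congr fun x _ => ?_
  simp [Complex.norm_def, Complex.normSq_apply, sq, Function.comp_def]

/-! ### Locality of the network constraints -/

namespace Feeder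

variable {N : ℕ} (F : Feeder N)

theorem trace_M_mul (n : Fin (N + 1)) (V : Matrix (Fin (N + 1)) (Fin (N + 1)) ℂ) :
    (F.M n * V).trace = V n n := by
  simp [M, Matrix.trace, Matrix.mul_apply, Matrix.single_apply, ite_and]

theorem Yn_apply (n i k : Fin (N + 1)) : F.Yn n i k = if i = n then F.Y n k else 0 := by
  by_cases h : i = n
  · subst h; simp [Yn]
  · rw [Yn, Matrix.single_mul_apply_of_ne _ _ _ _ _ h]
    simp [h]

theorem adj_of_Y_ne_zero {n k : Fin (N + 1)} (h : F.Y n k ≠ 0) : k = n ∨ F.lines.Adj n k := by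
  by_contra hc
  push Not at hc
  exact h (by simp [Y, hc.1.symm, hc.2])

end Feeder

namespace Clustering

variable {N Na : ℕ} {F : Feeder N} (K : Clustering F Na)

theorem mem_ext_of_adj {n k : Fin (N + 1)} (h : F.lines.Adj n k) : k ∈ K.ext (K.cluster n) := by
  classical
  simp only [ext, Finset.mem_filter, Finset.mem_univ, true_and]
  by_cases hk : K.cluster k = K.cluster n
  · exact Or.inl hk
  · exact Or.inr ⟨hk, n, h, rfl⟩

/-- Row `n` of the admittance matrix meets only `n` and its neighbours. This is why the constraints
of a node can be evaluated inside one extended cluster. -/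
theorem mem_ext_of_Yn_ne_zero {n i k : Fin (N + 1)} (h : F.Yn n i k ≠ 0) :
    i ∈ K.ext (K.cluster n) ∧ k ∈ K.ext (K.cluster n) := by
  rw [F.Yn_apply] at h
  split_ifs at h with hi
  · subst hi
    refine ⟨K.mem_ext_cluster i, ?_⟩
    rcases F.adj_of_Y_ne_zero h with rfl | hadj
    · exact K.mem_ext_cluster k
    · exact K.mem_ext_of_adj hadj
  · exact absurd rfl h

/-- A trace against a matrix that is supported in an extended cluster only involves the voltages
of that cluster. -/
theorem trace_sub_mul {a : Fin Na} {A : Matrix (Fin (N + 1)) (Fin (N + 1)) ℂ}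
    (hA : ∀ i k, A i k ≠ 0 → i ∈ K.ext a ∧ k ∈ K.ext a)
    (V : Matrix (Fin (N + 1)) (Fin (N + 1)) ℂ) :
    (K.sub a A * K.sub a V).trace = (A * V).trace := by
  simp only [trace, diag_apply, Matrix.mul_apply, sub, submatrix_apply]
  rw [Finset.sum_coe_sort (K.ext a) fun i => ∑ k : K.ext a, A i k * V k i]
  refine (Finset.sum_congr rfl fun i _ =>
    Finset.sum_coe_sort (K.ext a) fun k => A i k * V k i).trans ?_
  refine (Finset.sum_congr rfl fun i _ => Finset.sum_subset (Finset.subset_univ _) ?_).trans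
    (Finset.sum_subset (Finset.subset_univ _) ?_)
  · intro k _ hk
    by_contra h
    exact hk (hA i k (left_ne_zero_of_mul h)).2
  · intro i _ hi
    refine Finset.sum_eq_zero fun k _ => ?_
    by_contra h
    exact hi (hA i k (left_ne_zero_of_mul h)).1

theorem trace_sub_A {a : Fin Na} {n : Fin (N + 1)} (hn : K.cluster n = a)
    (V : Matrix (Fin (N + 1)) (Fin (N + 1)) ℂ) :
    (K.sub a (F.A n) * K.sub a V).trace = (F.A n * V).trace := by
  subst hn
  refine K.trace_sub_mul (fun i k h => ?_) V
  by_cases h1 : F.Yn n i k = 0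
  · by_cases h2 : F.Yn n k i = 0
    · exact absurd (by simp [Feeder.A, h1, h2]) h
    · exact (K.mem_ext_of_Yn_ne_zero h2).symm
  · exact K.mem_ext_of_Yn_ne_zero h1

theorem trace_sub_B {a : Fin Na} {n : Fin (N + 1)} (hn : K.cluster n = a)
    (V : Matrix (Fin (N + 1)) (Fin (N + 1)) ℂ) :
    (K.sub a (F.B n) * K.sub a V).trace = (F.B n * V).trace := by
  subst hn
  refine K.trace_sub_mul (fun i k h => ?_) V
  by_cases h1 : F.Yn n i k = 0
  · by_cases h2 : F.Yn n k i = 0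
    · exact absurd (by simp [Feeder.B, h1, h2]) h
    · exact (K.mem_ext_of_Yn_ne_zero h2).symm
  · exact K.mem_ext_of_Yn_ne_zero h1

theorem trace_sub_M {n : Fin (N + 1)}
    (X : Matrix (K.ext (K.cluster n)) (K.ext (K.cluster n)) ℂ) :
    (K.sub _ (F.M n) * X).trace = X ⟨n, K.mem_ext_cluster n⟩ ⟨n, K.mem_ext_cluster n⟩ := by
  have : K.sub (K.cluster n) (F.M n) =
      Matrix.single ⟨n, K.mem_ext_cluster n⟩ ⟨n, K.mem_ext_cluster n⟩ 1 := by
    ext i k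
    simp [sub, Feeder.M, Matrix.single_apply, Subtype.ext_iff]
  rw [this]
  simp [Matrix.trace, Matrix.mul_apply, Matrix.single_apply, ite_and]

theorem trace_sub_M' {a : Fin Na} {n : Fin (N + 1)} (hn : K.cluster n = a)
    (V : Matrix (Fin (N + 1)) (Fin (N + 1)) ℂ) :
    (K.sub a (F.M n) * K.sub a V).trace = (F.M n * V).trace := by
  subst hn
  rw [trace_sub_M, F.trace_M_mul]
  rfl

/-- The joint variables that belong to a network matrix and setpoints. -/
def embed (x : Matrix (Fin (N + 1)) (Fin (N + 1)) ℂ × (F.H → ℝ) × (F.H → ℝ)) : K.Joint :=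
  (fun a => K.sub a x.1, x.2.1, x.2.2, x.2.1, x.2.2)

theorem continuous_embed : Continuous K.embed := by
  have h : Continuous fun x : Matrix (Fin (N + 1)) (Fin (N + 1)) ℂ × (F.H → ℝ) × (F.H → ℝ) =>
      fun a => K.sub a x.1 := continuous_pi fun a => continuous_fst.matrix_submatrix _ _
  exact h.prodMk (by fun_prop)

theorem reading_embed (x : Matrix (Fin (N + 1)) (Fin (N + 1)) ℂ × (F.H → ℝ) × (F.H → ℝ))
    (i : K.Link) : K.reading (K.embed x) (K.swap i) = K.reading (K.embed x) i := by
  rcases i with ⟨k, (_ | _), (_ | _)⟩ | ⟨a, j, ⟨m, n⟩, (_ | _)⟩ <;> rfl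

end Clustering

/-! ### Equivalence of the centralized, cluster and joint problems -/

namespace Costs

variable {N Na : ℕ} {F : Feeder N} {K : Clustering F Na} (D : Costs K)

theorem embed_mem_jointFeasible {V : Matrix (Fin (N + 1)) (Fin (N + 1)) ℂ} {p q : F.H → ℝ}
    (hV : V.PosSemidef) :
    K.embed (V, p, q) ∈ D.jointFeasible ↔ (V, p, q) ∈ D.centralFeasible := by
  constructor
  · rintro ⟨h, hreg⟩
    refine ⟨hV, fun k => ?_, fun k => ?_, fun n hn => ?_, fun n => ?_, hreg⟩
    · rw [← K.trace_sub_A rfl]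
      exact (h (K.cluster k)).1.1 ⟨k, rfl⟩
    · rw [← K.trace_sub_B rfl]
      exact (h (K.cluster k)).1.2.1 ⟨k, rfl⟩
    · rw [← K.trace_sub_A rfl, ← K.trace_sub_B rfl]
      exact (h (K.cluster n)).1.2.2.1 n hn rfl
    · rw [← K.trace_sub_M' rfl]
      exact (h (K.cluster n)).1.2.2.2 n rfl
  · rintro ⟨-, hA, hB, hU, hM, hreg⟩
    refine ⟨fun a => ⟨⟨fun k => ?_, fun k => ?_, fun n hn hna => ?_, fun n hna => ?_⟩,
      hV.submatrix _⟩, hreg⟩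
    · change (K.sub a (F.A k.1) * K.sub a V).trace = _
      rw [K.trace_sub_A k.2]
      exact hA k.1
    · change (K.sub a (F.B k.1) * K.sub a V).trace = _
      rw [K.trace_sub_B k.2]
      exact hB k.1
    · change (K.sub a (F.A n) * K.sub a V).trace = 0 ∧ (K.sub a (F.B n) * K.sub a V).trace = 0
      rw [K.trace_sub_A hna, K.trace_sub_B hna]
      exact hU n hn
    · change _ ≤ (K.sub a (F.M n) * K.sub a V).trace.re ∧
        (K.sub a (F.M n) * K.sub a V).trace.re ≤ _
      rw [K.trace_sub_M' hna]
      exact hM n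

/-- Joint variables that satisfy the consensus constraints come from the centralized problem. -/
theorem exists_embed (htree : K.graph.IsTree) {x : K.Joint} (hx : x ∈ D.jointFeasible)
    (hcons : ∀ i, K.reading x (K.swap i) = K.reading x i) :
    ∃ V, (V, x.2.2.2.1, x.2.2.2.2) ∈ D.centralFeasible ∧
      K.embed (V, x.2.2.2.1, x.2.2.2.2) = x := by
  have hagree : K.Agree x.1 := by
    intro a j hj
    ext m n
    exact Complex.ext (hcons (.inr ⟨a, ⟨j, hj⟩, (m, n), true⟩)).symm
      (hcons (.inr ⟨a, ⟨j, hj⟩, (m, n), false⟩)).symm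
  obtain ⟨V, hV, hsub⟩ := K.exists_completion htree (fun a => (hx.1 a).2) hagree
  have he : K.embed (V, x.2.2.2.1, x.2.2.2.2) = x := by
    refine Prod.ext (funext hsub) (Prod.ext ?_ (Prod.ext ?_ rfl))
    · exact funext fun h => hcons (.inl (h, true, true))
    · exact funext fun h => hcons (.inl (h, true, false))
  exact ⟨V, (D.embed_mem_jointFeasible hV).1 (he ▸ hx), he⟩

theorem clusterCost_eq {V : Matrix (Fin (N + 1)) (Fin (N + 1)) ℂ} (hV : V.PosSemidef)
    (p q : F.H → ℝ) : D.clusterCost (V, p, q, p, q) = D.jointCost (K.embed (V, p, q)) := by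
  simp only [clusterCost, jointCost, Finset.sum_add_distrib, Clustering.embed,
    K.sum_houses fun h => D.R h (p h)]
  congr 1
  refine Finset.sum_congr rfl fun a _ => ?_
  rw [hermPart_of_isHermitian (X := K.sub a V) (hV.submatrix _).isHermitian]

theorem centralCost_eq {D : Costs K} (hdec : D.Decoupled)
    {V : Matrix (Fin (N + 1)) (Fin (N + 1)) ℂ} (hV : V.PosSemidef) (p q : F.H → ℝ) :
    D.centralCost (V, p, q) = D.jointCost (K.embed (V, p, q)) := by
  have h := hdec V hV p q
  rw [← D.clusterCost_eq hV]
  simp only [clusterCost, centralCost, Finset.sum_add_distrib, K.sum_houses fun h => D.R h (p h)]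
  linarith

theorem clusterFeasible_iff {V : Matrix (Fin (N + 1)) (Fin (N + 1)) ℂ} {p q pbar qbar : F.H → ℝ} :
    (V, p, q, pbar, qbar) ∈ D.clusterFeasible ↔
      (V, p, q) ∈ D.centralFeasible ∧ pbar = p ∧ qbar = q := by
  constructor
  · rintro ⟨hV, hflow, hreg, heq⟩
    obtain rfl : pbar = p := funext fun h => (heq h).1
    obtain rfl : qbar = q := funext fun h => (heq h).2
    exact ⟨(D.embed_mem_jointFeasible hV).1
      ⟨fun a => ⟨hflow a, hV.submatrix _⟩, hreg⟩, rfl, rfl⟩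
  · rintro ⟨h, rfl, rfl⟩
    have h' := (D.embed_mem_jointFeasible h.1).2 h
    exact ⟨h.1, fun a => (h'.1 a).1, h'.2, fun _ => ⟨rfl, rfl⟩⟩

/-- A minimizer of the joint cost over the consensus set solves both problems. -/
theorem isSolution_of_joint {D : Costs K} (hdec : D.Decoupled)
    {V : Matrix (Fin (N + 1)) (Fin (N + 1)) ℂ} {p q : F.H → ℝ}
    (hmem : (V, p, q) ∈ D.centralFeasible)
    (hmin : ∀ v ∈ D.jointFeasible, (∀ i, K.reading v (K.swap i) = K.reading v i) →
      D.jointCost (K.embed (V, p, q)) ≤ D.jointCost v) :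
    IsSolution D.centralCost D.centralFeasible (V, p, q) ∧
      IsSolution D.clusterCost D.clusterFeasible (V, p, q, p, q) := by
  have hmin' : ∀ V' p' q', (V', p', q') ∈ D.centralFeasible →
      D.jointCost (K.embed (V, p, q)) ≤ D.jointCost (K.embed (V', p', q')) :=
    fun V' p' q' h => hmin _ ((D.embed_mem_jointFeasible h.1).2 h) (K.reading_embed _)
  refine ⟨⟨hmem, ?_⟩, ⟨D.clusterFeasible_iff.2 ⟨hmem, rfl, rfl⟩, ?_⟩⟩
  · rw [isMinOn_iff]
    rintro ⟨V', p', q'⟩ h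
    rw [centralCost_eq hdec hmem.1, centralCost_eq hdec h.1]
    exact hmin' _ _ _ h
  · rw [isMinOn_iff]
    rintro ⟨V', p', q', pbar, qbar⟩ h
    obtain ⟨h, rfl, rfl⟩ := D.clusterFeasible_iff.1 h
    rw [clusterCost_eq _ hmem.1, clusterCost_eq _ h.1]
    exact hmin' _ _ _ h

/-! ### Convexity, continuity and compactness -/

theorem convexOn_jointCost {D : Costs K} (hR : ∀ h, ConvexOn ℝ Set.univ (D.R h))
    (hC : ∀ a, ConvexOn ℝ
      {z : Matrix (K.ext a) (K.ext a) ℂ × (K.Houses a → ℝ) | z.1.IsHermitian}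
      (fun z => D.C a z.1 z.2)) (hlamC : ∀ a, 0 ≤ D.lamC a) :
    ConvexOn ℝ Set.univ D.jointCost := by
  have hsum : ∀ {ι : Type} (s : Finset ι) (f : ι → K.Joint → ℝ),
      (∀ i, ConvexOn ℝ Set.univ (f i)) → ConvexOn ℝ Set.univ fun x => ∑ i ∈ s, f i x := by
    classical
    intro ι s f hf
    induction s using Finset.induction_on with
    | empty => simpa using convexOn_const (0 : ℝ) convex_univ
    | insert i s hi ih =>
      simp only [Finset.sum_insert hi]
      exact (hf i).add ih
  refine (hsum _ _ fun a => ?_).add (hsum _ _ fun h => ?_)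
  · unfold Cbar
    refine ConvexOn.add ?_ ?_
    -- `hermPart` is real linear with Hermitian values, so composing with it extends convexity from
    -- Hermitian matrices to the whole space.
    · let T : K.Joint →ₗ[ℝ] Matrix (K.ext a) (K.ext a) ℂ × (K.Houses a → ℝ) :=
        (hermPart ∘ₗ LinearMap.proj a ∘ₗ LinearMap.fst ℝ _ _).prod
          (LinearMap.funLeft ℝ ℝ (fun h : K.Houses a => h.1) ∘ₗ
            LinearMap.fst ℝ _ _ ∘ₗ LinearMap.snd ℝ _ _)
      have h := (hC a).comp_linearMap T
      have hT : T ⁻¹' {z | z.1.IsHermitian} = Set.univ :=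
        Set.eq_univ_of_forall fun x => hermPart_isHermitian _
      rw [hT] at h
      exact h
    · refine ConvexOn.smul (hlamC a) (hsum _ _ fun h => ?_)
      exact convexOn_sqrt_add_sq
        ((IsLinearMap.mk (fun _ _ => rfl) fun _ _ => rfl :
          IsLinearMap ℝ fun x : K.Joint => x.2.1 h.1).mk' _)
        ((IsLinearMap.mk (fun _ _ => rfl) fun _ _ => rfl :
          IsLinearMap ℝ fun x : K.Joint => x.2.2.1 h.1).mk' _)
  · exact (hR h).comp_linearMap ((IsLinearMap.mk (fun _ _ => rfl) fun _ _ => rfl :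
      IsLinearMap ℝ fun x : K.Joint => x.2.2.2.1 h).mk' _)

/-- A real convex function on a whole finite-dimensional space is locally Lipschitz. Matrices are
read as plain functions, which carry the sup norm. -/
theorem continuous_of_convexOn_joint {f : K.Joint → ℝ} (hf : ConvexOn ℝ Set.univ f) :
    Continuous f := by
  have key : ∀ g : (((a : Fin Na) → K.ext a → K.ext a → ℂ) × (F.H → ℝ) × (F.H → ℝ) × (F.H → ℝ) ×
      (F.H → ℝ)) → ℝ, ConvexOn ℝ Set.univ g → Continuous g :=
    fun g hg => hg.locallyLipschitz.continuous
  exact key f hf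

/-- The constraints that are not polyhedral. -/
def conicSet : Set K.Joint := {x | (∀ a, (hermPart (x.1 a)).PosSemidef) ∧
  ∀ h, x.2.2.2.2 h ^ 2 ≤ F.S h ^ 2 - (F.Pav h - x.2.2.2.1 h) ^ 2}

/-- The polyhedral constraints. -/
def polyhedralSet : Set K.Joint := {x |
  (∀ a, (x.1 a).IsHermitian ∧
    (x.1 a, (fun h : K.Houses a => x.2.1 h.1), (fun h : K.Houses a => x.2.2.1 h.1)) ∈ D.flows a) ∧
  ∀ h, 0 ≤ x.2.2.2.1 h ∧ x.2.2.2.1 h ≤ F.Pav h ∧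
    Real.cos F.θ * |x.2.2.2.2 h| ≤ Real.sin F.θ * (F.Pav h - x.2.2.2.1 h)}

/-- This is the splitting required by `exists_lagrange_multiplier`: semidefiniteness and the rating
discs need an interior point, while Hermitian symmetry counts as a linear constraint. -/
theorem jointFeasible_eq : D.jointFeasible = conicSet ∩ D.polyhedralSet := by
  ext x
  constructor
  · rintro ⟨h1, h2⟩
    refine ⟨⟨fun a => ?_, fun h => (h2 h).2.2.1⟩,
      fun a => ⟨(h1 a).2.isHermitian, (h1 a).1⟩, fun h => ⟨(h2 h).1, (h2 h).2.1, (h2 h).2.2.2⟩⟩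
    rw [hermPart_of_isHermitian (h1 a).2.isHermitian]
    exact (h1 a).2
  · rintro ⟨⟨h1, h2⟩, h3, h4⟩
    refine ⟨fun a => ⟨(h3 a).2, ?_⟩, fun h => ⟨(h4 h).1, (h4 h).2.1, h2 h, (h4 h).2.2⟩⟩
    have := h1 a
    rwa [hermPart_of_isHermitian (h3 a).1] at this

theorem convex_conicSet : Convex ℝ (conicSet : Set K.Joint) := by
  rintro x ⟨hx1, hx2⟩ y ⟨hy1, hy2⟩ a b ha hb hab
  refine ⟨fun c => ?_, fun h => ?_⟩
  · have := convex_posSemidef (hx1 c) (hy1 c) ha hb hab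
    have e : hermPart ((a • x + b • y).1 c) = a • hermPart (x.1 c) + b • hermPart (y.1 c) := by
      rw [← map_smul, ← map_smul, ← map_add]; rfl
    rw [e]
    exact this
  · have h1 := hx2 h
    have h2 := hy2 h
    have hb' : b = 1 - a := by linarith
    change (a * x.2.2.2.2 h + b * y.2.2.2.2 h) ^ 2 ≤
      F.S h ^ 2 - (F.Pav h - (a * x.2.2.2.1 h + b * y.2.2.2.1 h)) ^ 2
    -- The convexity defect of the squared Euclidean norm is explicit.
    have e : (a * x.2.2.2.2 h + b * y.2.2.2.2 h) ^ 2 +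
        (F.Pav h - (a * x.2.2.2.1 h + b * y.2.2.2.1 h)) ^ 2 =
        a * (x.2.2.2.2 h ^ 2 + (F.Pav h - x.2.2.2.1 h) ^ 2)
        + b * (y.2.2.2.2 h ^ 2 + (F.Pav h - y.2.2.2.1 h) ^ 2)
        - a * b * ((x.2.2.2.2 h - y.2.2.2.2 h) ^ 2 + (x.2.2.2.1 h - y.2.2.2.1 h) ^ 2) := by
      subst hb'; ring
    have h3 := mul_le_mul_of_nonneg_left h1 ha
    have h4 := mul_le_mul_of_nonneg_left h2 hb
    have h5 : 0 ≤ a * b * ((x.2.2.2.2 h - y.2.2.2.2 h) ^ 2 + (x.2.2.2.1 h - y.2.2.2.1 h) ^ 2) := by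
      positivity
    have h6 : a * F.S h ^ 2 + b * F.S h ^ 2 = F.S h ^ 2 := by rw [← add_mul, hab, one_mul]
    linarith

theorem isClosed_conicSet : IsClosed (conicSet : Set K.Joint) := by
  simp only [conicSet, Set.ofPred_and, Set.ofPred_forall]
  refine (isClosed_iInter fun a => ?_).inter (isClosed_iInter fun h => ?_)
  · exact isClosed_posSemidef.preimage
      (continuous_hermPart.comp ((continuous_apply a).comp continuous_fst))
  · exact isClosed_le (by fun_prop) (by fun_prop)

/-- The cone condition is put on `hermPart` for this purpose: semidefinite matrices themselves lie
in the real subspace of Hermitian ones and generally have no interior among all matrices. -/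
theorem embed_mem_interior_conicSet {V : Matrix (Fin (N + 1)) (Fin (N + 1)) ℂ} {p q : F.H → ℝ}
    (hV : V.PosDef) (hq : ∀ h, q h ^ 2 < F.S h ^ 2 - (F.Pav h - p h) ^ 2) :
    K.embed (V, p, q) ∈ interior (conicSet : Set K.Joint) := by
  rw [mem_interior_iff_mem_nhds]
  have h1 : ∀ a, ∀ᶠ x in 𝓝 (K.embed (V, p, q)), (hermPart (x.1 a)).PosSemidef := fun a => by
    have hc : Continuous fun x : K.Joint => x.1 a := (continuous_apply a).comp continuous_fst
    exact (hc.tendsto (K.embed (V, p, q))).eventually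
      (eventually_hermPart_posSemidef (hV.submatrix Subtype.val_injective))
  have h2 : ∀ h, ∀ᶠ x : K.Joint in 𝓝 (K.embed (V, p, q)),
      x.2.2.2.2 h ^ 2 ≤ F.S h ^ 2 - (F.Pav h - x.2.2.2.1 h) ^ 2 := fun h => by
    have hc1 : Continuous fun x : K.Joint => x.2.2.2.2 h ^ 2 := by fun_prop
    have hc2 : Continuous fun x : K.Joint => F.S h ^ 2 - (F.Pav h - x.2.2.2.1 h) ^ 2 := by fun_prop
    exact ((hc1.tendsto _).eventually_lt (hc2.tendsto _) (hq h)).mono fun _ h => h.le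
  exact (eventually_all.2 h1).and (eventually_all.2 h2)

theorem isPolyhedral_polyhedralSet {D : Costs K} (hθ : 0 ≤ F.θ ∧ F.θ ≤ Real.pi / 2) :
    IsPolyhedral D.polyhedralSet := by
  have htr : ∀ (a : Fin Na) (A : Matrix (K.ext a) (K.ext a) ℂ),
      IsLinearMap ℝ fun x : K.Joint => (A * x.1 a).trace.re := fun a A =>
    ⟨fun x y => by simp [Matrix.mul_add], fun c x => by simp⟩
  have htr' : ∀ (a : Fin Na) (A : Matrix (K.ext a) (K.ext a) ℂ),
      IsLinearMap ℝ fun x : K.Joint => (A * x.1 a).trace.im := fun a A =>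
    ⟨fun x y => by simp [Matrix.mul_add], fun c x => by simp⟩
  have hcos : 0 ≤ Real.cos F.θ :=
    Real.cos_nonneg_of_neg_pi_div_two_le_of_le (by linarith [Real.pi_pos]) hθ.2
  refine IsPolyhedral.and (.forall_mem fun a => .and ?_ (.and (.forall_mem fun h => ?_)
    (.and (.forall_mem fun h => ?_) (.and (.forall_mem fun n => .of_imp fun _ => .of_imp fun _ =>
      .and ?_ ?_) (.forall_mem fun n => .of_imp fun _ => .and ?_ ?_)))))
    (.forall_mem fun h => .and ?_ (.and ?_ ?_))
  · have : IsPolyhedral {x : K.Joint | ∀ mn : K.ext a × K.ext a,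
        (x.1 a mn.2 mn.1).re - (x.1 a mn.1 mn.2).re = 0 ∧
        (x.1 a mn.2 mn.1).im + (x.1 a mn.1 mn.2).im = 0} :=
      .forall_mem fun mn => .and
        (.eq_const ⟨fun x y => by simp; ring, fun c x => by simp; ring⟩ 0)
        (.eq_const ⟨fun x y => by simp; ring, fun c x => by simp; ring⟩ 0)
    refine this.congr fun x => ?_
    rw [show (x.1 a).IsHermitian ↔ (x.1 a)ᴴ = x.1 a from Iff.rfl, ← Matrix.ext_iff]
    simp only [conjTranspose_apply, Complex.ext_iff, RCLike.star_def, Complex.conj_re,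
      Complex.conj_im, Prod.forall, sub_eq_zero, neg_eq_iff_add_eq_zero]
  · have : IsPolyhedral {x : K.Joint | (K.sub a (F.A h.1) * x.1 a).trace.re + x.2.1 h.1
        = -F.Pl h.1 + F.Pav h.1 ∧ (K.sub a (F.A h.1) * x.1 a).trace.im = 0} :=
      .and (.eq_const ⟨fun x y => by simp [Matrix.mul_add]; ring, fun c x => by simp; ring⟩ _)
        (.eq_const (htr' _ _) 0)
    refine this.congr fun x => ?_
    rw [Complex.ext_iff, Complex.ofReal_re, Complex.ofReal_im, eq_sub_iff_add_eq]
  · have : IsPolyhedral {x : K.Joint | (K.sub a (F.B h.1) * x.1 a).trace.re - x.2.2.1 h.1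
        = -F.Ql h.1 ∧ (K.sub a (F.B h.1) * x.1 a).trace.im = 0} :=
      .and (.eq_const ⟨fun x y => by simp [Matrix.mul_add]; ring, fun c x => by simp; ring⟩ _)
        (.eq_const (htr' _ _) 0)
    refine this.congr fun x => ?_
    rw [Complex.ext_iff, Complex.ofReal_re, Complex.ofReal_im, sub_eq_iff_eq_add]
  · simp only [Complex.ext_iff]
    exact .and (.eq_const (htr _ _) _) (.eq_const (htr' _ _) _)
  · simp only [Complex.ext_iff]
    exact .and (.eq_const (htr _ _) _) (.eq_const (htr' _ _) _)
  · exact .const_le (htr _ _) _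
  · exact .le_const (htr _ _) _
  · exact .const_le ⟨fun x y => rfl, fun c x => rfl⟩ _
  · exact .le_const ⟨fun x y => rfl, fun c x => rfl⟩ _
  -- Since cos θ ≥ 0, the bound on the absolute value is a pair of linear inequalities.
  · have : IsPolyhedral {x : K.Joint |
        -(Real.sin F.θ * F.Pav h) ≤ Real.cos F.θ * x.2.2.2.2 h - Real.sin F.θ * x.2.2.2.1 h ∧
        Real.cos F.θ * x.2.2.2.2 h + Real.sin F.θ * x.2.2.2.1 h ≤ Real.sin F.θ * F.Pav h} :=
      .and (.const_le ⟨fun x y => by simp; ring, fun c x => by simp; ring⟩ _)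
        (.le_const ⟨fun x y => by simp; ring, fun c x => by simp; ring⟩ _)
    refine this.congr fun x => ?_
    rw [← abs_of_nonneg hcos, ← abs_mul, abs_of_nonneg hcos, abs_le]
    constructor <;> rintro ⟨h1, h2⟩ <;> constructor <;> linarith

theorem convex_jointFeasible {D : Costs K} (hθ : 0 ≤ F.θ ∧ F.θ ≤ Real.pi / 2) :
    Convex ℝ D.jointFeasible := by
  rw [jointFeasible_eq]
  exact convex_conicSet.inter (isPolyhedral_polyhedralSet hθ).convex

theorem isClosed_jointFeasible {D : Costs K} (hθ : 0 ≤ F.θ ∧ F.θ ≤ Real.pi / 2) :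
    IsClosed D.jointFeasible := by
  rw [jointFeasible_eq]
  have : FiniteDimensional ℝ K.Joint := by
    change FiniteDimensional ℝ (((a : Fin Na) → K.ext a → K.ext a → ℂ) × (F.H → ℝ) ×
      (F.H → ℝ) × (F.H → ℝ) × (F.H → ℝ))
    infer_instance
  exact isClosed_conicSet.inter (isPolyhedral_polyhedralSet hθ).isClosed

end Costs

/-! ### Compactness, saddle points and convergence of runs -/

namespace Costs

variable {N Na : ℕ} {F : Feeder N} {K : Clustering F Na} (D : Costs K)

/-- Semidefiniteness reduces the bound to the diagonal. Nodes of cluster `a` obey the upper voltage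
limit, and foreign nodes lie on ties, where the diagonal entry is itself a reading. -/
theorem norm_le_of_mem_jointFeasible {x : K.Joint} (hx : x ∈ D.jointFeasible) {r : ℝ}
    (hr : ∀ i, |K.reading x i| ≤ r) (a : Fin Na) (m n : K.ext a) :
    ‖x.1 a m n‖ ≤ max (F.Vmax ^ 2) r := by
  refine norm_apply_le_of_posSemidef (hx.1 a).2 (fun k => ?_) m n
  obtain ⟨k, hk⟩ := k
  by_cases h : K.cluster k = a
  · subst h
    have := ((hx.1 _).1.2.2.2 k rfl).2
    rw [K.trace_sub_M] at this
    exact this.trans (le_max_left _ _)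
  · obtain ⟨h1, h2⟩ := K.mem_tie_of_mem_ext hk h
    exact ((le_abs_self _).trans (hr (.inr ⟨a, ⟨_, h2⟩, (⟨k, h1⟩, ⟨k, h1⟩), true⟩))).trans
      (le_max_right _ _)

/-- Cluster matrices with bounded entries. -/
def boundedMatrices (K : Clustering F Na) (r : ℝ) :
    Set ((a : Fin Na) → Matrix (K.ext a) (K.ext a) ℂ) :=
  Set.univ.pi fun _ => Set.univ.pi fun _ => Set.univ.pi fun _ => Metric.closedBall (0 : ℂ) r

theorem mem_boundedMatrices {r : ℝ} {W : (a : Fin Na) → Matrix (K.ext a) (K.ext a) ℂ} :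
    W ∈ boundedMatrices K r ↔ ∀ a m n, ‖W a m n‖ ≤ r := by
  exact ⟨fun h a m n => mem_closedBall_zero_iff.1 (h a trivial m trivial n trivial),
    fun h a _ m _ n _ => mem_closedBall_zero_iff.2 (h a m n)⟩

theorem isCompact_boundedMatrices (r : ℝ) : IsCompact (boundedMatrices K r) :=
  isCompact_univ_pi fun _ => isCompact_univ_pi fun _ => isCompact_univ_pi fun _ =>
    isCompact_closedBall _ _

theorem exists_isCompact_of_reading_le (r : ℝ) : ∃ Q : Set K.Joint, IsCompact Q ∧
    ∀ x ∈ D.jointFeasible, (∀ i, |K.reading x i| ≤ r) → x ∈ Q := by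
  have hbox : IsCompact (Set.univ.pi fun _ : F.H => Set.Icc (-r) r) :=
    isCompact_univ_pi fun _ => isCompact_Icc
  refine ⟨_, (isCompact_boundedMatrices (max (F.Vmax ^ 2) r)).prod
    (hbox.prod (hbox.prod (hbox.prod hbox))), fun x hx hr => ⟨?_, ?_, ?_, ?_, ?_⟩⟩
  · exact mem_boundedMatrices.2 (D.norm_le_of_mem_jointFeasible hx hr)
  · exact fun h _ => abs_le.1 (hr (.inl (h, true, true)))
  · exact fun h _ => abs_le.1 (hr (.inl (h, true, false)))
  · exact fun h _ => abs_le.1 (hr (.inl (h, false, true)))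
  · exact fun h _ => abs_le.1 (hr (.inl (h, false, false)))

/-- Provides the primal optimum at which multipliers are sought. Boundedness comes from the voltage
limits on the diagonal and from the inverter regions. -/
theorem isCompact_centralFeasible {D : Costs K} (hθ : 0 ≤ F.θ ∧ F.θ ≤ Real.pi / 2) :
    IsCompact D.centralFeasible := by
  have hclosed : IsClosed D.centralFeasible := by
    have : D.centralFeasible = {x | x.1.PosSemidef} ∩ K.embed ⁻¹' D.jointFeasible := by
      ext ⟨V, p, q⟩
      constructor
      · exact fun h => ⟨h.1, (D.embed_mem_jointFeasible h.1).2 h⟩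
      · exact fun h => (D.embed_mem_jointFeasible h.1).1 h.2
    rw [this]
    exact (isClosed_posSemidef.preimage continuous_fst).inter
      ((isClosed_jointFeasible hθ).preimage K.continuous_embed)
  have hQ : IsCompact ((Set.univ.pi fun _ : Fin (N + 1) => Set.univ.pi fun _ : Fin (N + 1) =>
      Metric.closedBall (0 : ℂ) (F.Vmax ^ 2)) ×ˢ ((Set.univ.pi fun h : F.H =>
      Set.Icc 0 (F.Pav h)) ×ˢ (Set.univ.pi fun h : F.H => Set.Icc (-|F.S h|) |F.S h|))) :=
    (isCompact_univ_pi fun _ => isCompact_univ_pi fun _ => isCompact_closedBall _ _).prod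
      ((isCompact_univ_pi fun _ => isCompact_Icc).prod (isCompact_univ_pi fun _ => isCompact_Icc))
  refine IsCompact.of_isClosed_subset (s := (show Set D.CentralVar from _)) hQ hclosed ?_
  rintro ⟨V, p, q⟩ ⟨hV, -, -, -, hM, hreg⟩
  refine ⟨fun m _ n _ => ?_, fun h _ => ⟨(hreg h).1, (hreg h).2.1⟩, fun h _ => ?_⟩
  · rw [mem_closedBall_zero_iff]
    refine norm_apply_le_of_posSemidef hV (fun k => ?_) m n
    have := (hM k).2
    rwa [F.trace_M_mul] at this
  · refine abs_le.1 (sq_le_sq.1 ?_)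
    have := (hreg h).2.2.1
    nlinarith [sq_nonneg (F.Pav h - p h)]

/-- A saddle point of the Lagrangian of the consensus constraints. -/
theorem exists_saddle {D : Costs K} (hθ : 0 ≤ F.θ ∧ F.θ ≤ Real.pi / 2)
    (hconv : ConvexOn ℝ Set.univ D.jointCost) (htree : K.graph.IsTree)
    (hslater : D.StrictlyFeasible) :
    ∃ x ∈ D.jointFeasible, (∀ i, K.reading x (K.swap i) = K.reading x i) ∧
      ∃ y : K.Link → ℝ, (∀ i, y (K.swap i) = -y i) ∧
        ∀ v ∈ D.jointFeasible, D.jointCost x ≤ D.jointCost v + ∑ i, y i * K.reading v i := by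
  have hcont := continuous_of_convexOn_joint hconv
  obtain ⟨V₁, p₁, q₁, hmem₁, hpd, hstrict⟩ := hslater
  obtain ⟨⟨V₀, p₀, q₀⟩, hmem₀, hmin₀⟩ := (isCompact_centralFeasible hθ).exists_isMinOn ⟨_, hmem₁⟩
    (hcont.comp K.continuous_embed).continuousOn
  have hx₀ := (D.embed_mem_jointFeasible hmem₀.1).2 hmem₀
  have hx₁ := (D.embed_mem_jointFeasible hmem₁.1).2 hmem₁
  have hx₀' := hx₀
  have hx₁' := hx₁
  rw [jointFeasible_eq] at hx₀' hx₁'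
  let L : K.Link → K.Joint →ₗ[ℝ] ℝ := fun i =>
    LinearMap.proj i ∘ₗ K.reading - LinearMap.proj (K.swap i) ∘ₗ K.reading
  have hL : ∀ i x, L i x = K.reading x i - K.reading x (K.swap i) := fun _ _ => rfl
  obtain ⟨c, hc⟩ := exists_lagrange_multiplier hconv hcont convex_conicSet
    (isPolyhedral_polyhedralSet (D := D) hθ) L (embed_mem_interior_conicSet hpd hstrict) hx₁'.2
    (fun i => by rw [hL, K.reading_embed, sub_self]) hx₀'.1 hx₀'.2
    (fun i => by rw [hL, K.reading_embed, sub_self]) (by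
      rw [← jointFeasible_eq]
      intro x hx hxL
      -- By the tree completion, every competitor at consensus comes from a centralized feasible
      -- point.
      obtain ⟨V, hV, he⟩ := D.exists_embed htree hx fun i => (sub_eq_zero.1 (hxL i)).symm
      rw [← he]
      exact isMinOn_iff.1 hmin₀ _ hV)
  -- `c` multiplies the differences of a reading and its counterpart; moving the weights onto the
  -- readings antisymmetrizes them.
  refine ⟨_, hx₀, K.reading_embed _, fun i => c i - c (K.swap i), fun i => ?_, fun v hv => ?_⟩
  · simp only [K.swap_involutive i, neg_sub]
  · rw [jointFeasible_eq] at hv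
    refine (hc v hv).trans (le_of_eq ?_)
    have h1 : ∑ i, c (K.swap i) * K.reading v (K.swap (K.swap i)) =
        ∑ i, c i * K.reading v (K.swap i) :=
      Equiv.sum_comp (K.swap_involutive.toPerm _) fun i => c i * K.reading v (K.swap i)
    simp only [K.swap_involutive _] at h1
    simp only [hL, mul_sub, sub_mul, Finset.sum_sub_distrib, h1]

/-- Convergence of the exchanged quantities and of the multipliers, and optimality of the limit
points. -/
theorem IsRun.converges {D : Costs K} (hθ : 0 ≤ F.θ ∧ F.θ ≤ Real.pi / 2)
    (hconv : ConvexOn ℝ Set.univ D.jointCost) (htree : K.graph.IsTree)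
    (hslater : D.StrictlyFeasible) {κ : ℝ} (hκ : 0 < κ) {x : ℕ → Iterate K} (hx : D.IsRun κ x) :
    ∃ y z : K.Link → ℝ, Tendsto (fun i => (x i).multiplier) atTop (𝓝 y) ∧
      Tendsto (fun i => K.reading (x i).joint) atTop (𝓝 z) ∧ (∀ i, z (K.swap i) = z i) ∧
      ∀ U : Ultrafilter ℕ, (U : Filter ℕ) ≤ atTop → ∀ X,
        Tendsto (fun i => (x i).joint) U (𝓝 X) →
        X ∈ D.jointFeasible ∧ K.reading X = z ∧
          ∀ v ∈ D.jointFeasible, (∀ i, K.reading v (K.swap i) = K.reading v i) →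
            D.jointCost X ≤ D.jointCost v := by
  obtain ⟨xs, hxs, hxsL, ys, hys, hsaddle⟩ := exists_saddle hθ hconv htree hslater
  exact consensus_admm (hconv.subset (Set.subset_univ _) (convex_jointFeasible hθ))
    (continuous_of_convexOn_joint hconv).continuousOn (isClosed_jointFeasible hθ) K.reading
    K.continuous_reading hκ K.swap_involutive D.exists_isCompact_of_reading_le hxs hxsL hys hsaddle
    (fun i => (x i).joint) (fun i => (x i).multiplier)
    (fun k => ((hx.step k).augmented_le hκ).1) (by simp [hx.multiplier_zero])
    (fun k i => (hx.step k).multiplier_eq i) (fun k => ((hx.step k).augmented_le hκ).2)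

/-- The cluster voltages of a run are bounded. -/
theorem IsRun.exists_bound {D : Costs K} {κ : ℝ} (hκ : 0 < κ) {x : ℕ → Iterate K}
    (hx : D.IsRun κ x) {z : K.Link → ℝ}
    (hz : Tendsto (fun i => K.reading (x i).joint) atTop (𝓝 z)) :
    ∃ r : ℝ, ∀ i a m n, ‖(x i).V a m n‖ ≤ r := by
  obtain ⟨ρ, hρ⟩ := (Metric.isBounded_range_of_tendsto _ hz).exists_norm_le
  have hρ' : ∀ k i, |K.reading (x k).joint i| ≤ ρ := fun k i =>
    (norm_le_pi_norm (K.reading (x k).joint) i).trans (hρ _ ⟨k, rfl⟩)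
  -- The initial voltages are arbitrary, not feasible, so their entries are added to the bound.
  refine ⟨max (F.Vmax ^ 2) ρ + ∑ a, ∑ m, ∑ n, ‖(x 0).V a m n‖, fun k a m n => ?_⟩
  have hnn : 0 ≤ ∑ a, ∑ m, ∑ n, ‖(x 0).V a m n‖ := by positivity
  have hV : 0 ≤ max (F.Vmax ^ 2) ρ := (sq_nonneg _).trans (le_max_left _ _)
  rcases k with _ | k
  · have h1 := Finset.single_le_sum (f := fun n => ‖(x 0).V a m n‖) (fun _ _ => norm_nonneg _)
      (Finset.mem_univ n)
    have h2 := Finset.single_le_sum (f := fun m => ∑ n, ‖(x 0).V a m n‖)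
      (fun _ _ => by positivity) (Finset.mem_univ m)
    have h3 := Finset.single_le_sum (f := fun a => ∑ m, ∑ n, ‖(x 0).V a m n‖)
      (fun _ _ => by positivity) (Finset.mem_univ a)
    linarith
  · have := D.norm_le_of_mem_jointFeasible ((hx.step k).augmented_le hκ).1 (hρ' (k + 1)) a m n
    exact this.trans (le_add_of_nonneg_right hnn)

end Costs

end OID

end

/-! ### The convergence theorem -/

theorem proposition3 {N Na : ℕ} (F : OID.Feeder N) (K : OID.Clustering F Na) (D : OID.Costs K)
    (hθ : 0 ≤ F.θ ∧ F.θ ≤ Real.pi / 2)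
    (hR : ∀ h, ConvexOn ℝ Set.univ (D.R h))
    (hC : ∀ a, ConvexOn ℝ
      {z : Matrix (K.ext a) (K.ext a) ℂ × (K.Houses a → ℝ) | z.1.IsHermitian}
      (fun z => D.C a z.1 z.2))
    (hlam : 0 ≤ D.lam) (hlamC : ∀ a, 0 ≤ D.lamC a)
    (hdec : D.Decoupled)
    (htree : K.graph.IsTree)
    (hslater : D.StrictlyFeasible)
    (κ : ℝ) (hκ : 0 < κ) (x : ℕ → OID.Iterate K) (hx : D.IsRun κ x) :
    ∃ (p q γ μ : F.H → ℝ) (Υ Ψ : (a j : Fin Na) → Matrix (K.tie a j) (K.tie a j) ℝ)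
      (T : (a j : Fin Na) → Matrix (K.tie a j) (K.tie a j) ℂ),
      -- setpoints, their copies, all multipliers and the tie-line voltages converge
      Tendsto (fun i => (x i).p) atTop (𝓝 p) ∧
      Tendsto (fun i => (x i).q) atTop (𝓝 q) ∧
      Tendsto (fun i => (x i).pbar) atTop (𝓝 p) ∧
      Tendsto (fun i => (x i).qbar) atTop (𝓝 q) ∧
      Tendsto (fun i => (x i).γ) atTop (𝓝 γ) ∧
      Tendsto (fun i => (x i).μ) atTop (𝓝 μ) ∧
      (∀ a, ∀ j ∈ K.nbr a,
        Tendsto (fun i => (x i).Υ a j) atTop (𝓝 (Υ a j)) ∧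
        Tendsto (fun i => (x i).Ψ a j) atTop (𝓝 (Ψ a j)) ∧
        Tendsto (fun i => K.own a j ((x i).V a)) atTop (𝓝 (T a j)) ∧
        Tendsto (fun i => K.other a j ((x i).V j)) atTop (𝓝 (T a j))) ∧
      -- the cluster voltages are bounded, and each of their limit points gives a solution
      (∃ r : ℝ, ∀ i a m n, ‖(x i).V a m n‖ ≤ r) ∧
      (∀ W : (a : Fin Na) → Matrix (K.ext a) (K.ext a) ℂ,
        MapClusterPt W atTop (fun i => (x i).V) →
        ∃ V, (∀ a, K.sub a V = W a) ∧
          OID.IsSolution D.centralCost D.centralFeasible (V, p, q) ∧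
          OID.IsSolution D.clusterCost D.clusterFeasible (V, p, q, p, q)) ∧
      -- the cluster voltages converge to those of a solution
      (D.VoltagesDetermined →
        ∃ V, (∀ a, Tendsto (fun i => (x i).V a) atTop (𝓝 (K.sub a V))) ∧
          OID.IsSolution D.centralCost D.centralFeasible (V, p, q) ∧
          OID.IsSolution D.clusterCost D.clusterFeasible (V, p, q, p, q)) := by
  classical
  have hconv := OID.Costs.convexOn_jointCost hR hC hlamC
  obtain ⟨y, z, hy, hz, hzσ, hU⟩ := hx.converges hθ hconv htree hslater hκ
  obtain ⟨r, hr⟩ := hx.exists_bound hκ hz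
  have hyi := tendsto_pi_nhds.1 hy
  have hzi := tendsto_pi_nhds.1 hz
  let p : F.H → ℝ := fun h => z (.inl (h, false, true))
  let q : F.H → ℝ := fun h => z (.inl (h, false, false))
  let T : (a j : Fin Na) → Matrix (K.tie a j) (K.tie a j) ℂ := fun a j m n =>
    if hj : j ∈ K.nbr a then
      ⟨z (.inr ⟨a, ⟨j, hj⟩, (m, n), true⟩), z (.inr ⟨a, ⟨j, hj⟩, (m, n), false⟩)⟩ else 0
  have hp : Tendsto (fun i => (x i).p) atTop (𝓝 p) :=
    tendsto_pi_nhds.2 fun h => hzi (.inl (h, false, true))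
  have hq : Tendsto (fun i => (x i).q) atTop (𝓝 q) :=
    tendsto_pi_nhds.2 fun h => hzi (.inl (h, false, false))
  have hpbar : Tendsto (fun i => (x i).pbar) atTop (𝓝 p) := by
    refine tendsto_pi_nhds.2 fun h => ?_
    have := hzi (.inl (h, true, true))
    rwa [← hzσ] at this
  have hqbar : Tendsto (fun i => (x i).qbar) atTop (𝓝 q) := by
    refine tendsto_pi_nhds.2 fun h => ?_
    have := hzi (.inl (h, true, false))
    rwa [← hzσ] at this
  have hcomplex : ∀ {f : ℕ → ℂ} {c : ℂ}, Tendsto (fun i => (f i).re) atTop (𝓝 c.re) →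
      Tendsto (fun i => (f i).im) atTop (𝓝 c.im) → Tendsto f atTop (𝓝 c) := by
    intro f c hre him
    have := (Complex.continuous_ofReal.tendsto _ |>.comp hre).add
      ((Complex.continuous_ofReal.tendsto _ |>.comp him).mul_const Complex.I)
    simpa [Function.comp_def, Complex.re_add_im] using this
  have hown : ∀ a, ∀ j ∈ K.nbr a, Tendsto (fun i => K.own a j ((x i).V a)) atTop (𝓝 (T a j)) := by
    intro a j hj
    refine tendsto_pi_nhds.2 fun m => tendsto_pi_nhds.2 fun n => ?_
    simp only [T, hj, dite_true]
    exact hcomplex (hzi (.inr ⟨a, ⟨j, hj⟩, (m, n), true⟩))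
      (hzi (.inr ⟨a, ⟨j, hj⟩, (m, n), false⟩))
  have hother : ∀ a, ∀ j ∈ K.nbr a,
      Tendsto (fun i => K.other a j ((x i).V j)) atTop (𝓝 (T a j)) := by
    intro a j hj
    refine tendsto_pi_nhds.2 fun m => tendsto_pi_nhds.2 fun n => ?_
    simp only [T, hj, dite_true]
    rw [← hzσ (.inr ⟨a, ⟨j, hj⟩, (m, n), true⟩), ← hzσ (.inr ⟨a, ⟨j, hj⟩, (m, n), false⟩)]
    exact hcomplex (hzi (K.swap (.inr ⟨a, ⟨j, hj⟩, (m, n), true⟩)))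
      (hzi (K.swap (.inr ⟨a, ⟨j, hj⟩, (m, n), false⟩)))
  have hlimit : ∀ W : (a : Fin Na) → Matrix (K.ext a) (K.ext a) ℂ,
      MapClusterPt W atTop (fun i => (x i).V) →
      ∃ V, (∀ a, K.sub a V = W a) ∧
        OID.IsSolution D.centralCost D.centralFeasible (V, p, q) ∧
        OID.IsSolution D.clusterCost D.clusterFeasible (V, p, q, p, q) := by
    intro W hW
    -- The setpoints and their copies already converge, so an ultrafilter that carries the voltages
    -- to `W` carries the whole joint iterate to a limit.
    obtain ⟨U, hUle, hUW⟩ := mapClusterPt_iff_ultrafilter.1 hW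
    obtain ⟨hmem, hread, hmin⟩ := hU U hUle (W, p, q, p, q)
      (hUW.prodMk_nhds ((hpbar.mono_left hUle).prodMk_nhds ((hqbar.mono_left hUle).prodMk_nhds
        ((hp.mono_left hUle).prodMk_nhds (hq.mono_left hUle)))))
    obtain ⟨V, hV, he⟩ := D.exists_embed htree hmem fun i => by rw [hread, hzσ]
    refine ⟨V, fun a => congrFun (congrArg Prod.fst he) a, ?_⟩
    refine OID.Costs.isSolution_of_joint hdec hV fun v hv hvσ => ?_
    rw [he]
    exact hmin v hv hvσ
  refine ⟨p, q, fun h => y (.inl (h, true, true)), fun h => y (.inl (h, true, false)),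
    fun a j m n => if hj : j ∈ K.nbr a then y (.inr ⟨a, ⟨j, hj⟩, (m, n), true⟩) else 0,
    fun a j m n => if hj : j ∈ K.nbr a then y (.inr ⟨a, ⟨j, hj⟩, (m, n), false⟩) else 0,
    T, hp, hq, hpbar, hqbar, tendsto_pi_nhds.2 fun h => hyi (.inl (h, true, true)),
    tendsto_pi_nhds.2 fun h => hyi (.inl (h, true, false)),
    fun a j hj => ⟨?_, ?_, hown a j hj, hother a j hj⟩, ⟨r, hr⟩, hlimit, fun hdet => ?_⟩
  · refine tendsto_pi_nhds.2 fun m => tendsto_pi_nhds.2 fun n => ?_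
    simp only [hj, dite_true]
    exact hyi (.inr ⟨a, ⟨j, hj⟩, (m, n), true⟩)
  · refine tendsto_pi_nhds.2 fun m => tendsto_pi_nhds.2 fun n => ?_
    simp only [hj, dite_true]
    exact hyi (.inr ⟨a, ⟨j, hj⟩, (m, n), false⟩)
  · have hcpt := OID.Costs.isCompact_boundedMatrices (K := K) r
    have hin : ∀ i, (x i).V ∈ OID.Costs.boundedMatrices K r := fun i =>
      OID.Costs.mem_boundedMatrices.2 (hr i)
    have hin' : Filter.map (fun i => (x i).V) atTop ≤ 𝓟 (OID.Costs.boundedMatrices K r) :=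
      le_principal_iff.2 (Filter.mem_map.2 (Filter.univ_mem' hin))
    obtain ⟨W, -, hW⟩ := hcpt hin'
    obtain ⟨V, hVW, hV⟩ := hlimit W hW
    have hties : ∀ W', MapClusterPt W' atTop (fun i => (x i).V) → ∀ a, ∀ j ∈ K.nbr a,
        K.own a j (W' a) = T a j := by
      intro W' hW' a j hj
      obtain ⟨U, hUle, hUW⟩ := mapClusterPt_iff_ultrafilter.1 hW'
      have hc : Continuous fun W : (a : Fin Na) → Matrix (K.ext a) (K.ext a) ℂ => K.own a j (W a) :=
        (continuous_apply a).matrix_submatrix _ _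
      exact tendsto_nhds_unique ((hc.tendsto W').comp hUW) ((hown a j hj).mono_left hUle)
    -- All cluster points give solutions with the same setpoints and the same tie voltages, so
    -- `hdet` makes them equal; in a compact set a unique cluster point is the limit.
    have hlim : Tendsto (fun i => (x i).V) atTop (𝓝 W) := by
      refine hcpt.le_nhds_of_unique_clusterPt (le_principal_iff.1 hin') fun W' _ hW' => ?_
      obtain ⟨V', hVW', hV'⟩ := hlimit W' hW'
      funext a
      rw [← hVW' a, ← hVW a]
      refine hdet V' V p q hV'.2 hV.2 (fun a j hj => ?_) a
      rw [hVW', hVW, hties W' hW' a j hj, hties W hW a j hj]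
    refine ⟨V, fun a => ?_, hV⟩
    rw [hVW a]
    exact tendsto_pi_nhds.1 hlim a
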